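/- Let $q_0,q_1,q_2\in\mathbb R^2$ be the vertices of an equilateral triangle (indices are read mod 3), let $F_i(x)=\frac12(x-q_i)+q_i$, and let $SG$ be the Sierpinski gasket, i.e. the unique nonempty compact set with $SG=\bigcup_{i=0}^2F_i(SG)$. For a word $w=(w_1,\dots,w_m)\in\{0,1,2\}^m$ put $F_w=F_{w_1}\circ\dots\circ F_{w_m}$; the sets $F_w(SG)$ are the cells of level $m$, and $\mu$ is the self-similar probability measure on $SG$ that gives mass $3^{-m}$ to each cell of level $m$. Write $\langle u,v\rangle=\int_{SG}uv\,d\mu$ and $\|u\|_{L^2}^2=\langle u,u\rangle$. Let $V_0=\{q_0,q_1,q_2\}$ and $V_{m+1}=\bigcup_iF_i(V_m)$; for $x,y\in V_m$ write $x\sim_m y$ if $x\ne y$ and $x,y$ lie in a common cell of level $m$; and put $\Delta_mu(x)=\sum_{y\sim_mx}(u(y)-u(x))$ for $x\in V_m\setminus V_0$. For continuous $u,f:SG\to\mathbb R$ we say that $\Delta u=f$ if $$\lim_{m\to\infty}\ \max_{x\in V_m\setminus V_0}\Big|\tfrac32\,5^m\Delta_mu(x)-f(x)\Big|=0 .$$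 The normal and tangential derivatives at $q_i$ are $$\partial_nu(q_i)=\lim_{m\to\infty}\big(\tfrac53\big)^m\big(2u(q_i)-u(F_i^mq_{i+1})-u(F_i^mq_{i-1})\big),\qquad \partial_Tu(q_i)=\lim_{m\to\infty}5^m\big(u(F_i^mq_{i+1})-u(F_i^mq_{i-1})\big).$$ For $j\ge0$ and $n\in\{0,1,2\}$, the antisymmetric monomial $P_{j3}^{(n)}$ is the function with $\Delta^{j+1}P_{j3}^{(n)}=0$ such that, for all $0\le m\le j$, $$\Delta^mP_{j3}^{(n)}(q_n)=0,\qquad \partial_n\Delta^mP_{j3}^{(n)}(q_n)=0,\qquad \partial_T\Delta^mP_{j3}^{(n)}(q_n)=\delta_{mj}.$$ **Theorem.** For each $j\ge0$ the functions $P_{j3}^{(0)},P_{j3}^{(1)},P_{j3}^{(2)}$ exist and are unique, their span $\mathcal F_j=\operatorname{span}\{P_{j3}^{(0)},P_{j3}^{(1)},P_{j3}^{(2)}\}$ is two-dimensional, and they form a tight frame for $\mathcal F_j$ in $L^2(SG,\mu)$ with frame bound $A_j=\frac32\|P_{j3}^{(0)}\|_{L^2}^2>0$. That is, for every $P\in\mathcal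 F_j$, $$\sum_{n=0}^2\langle P,P_{j3}^{(n)}\rangle^2=A_j\|P\|_{L^2}^2,\qquad\text{and}\qquad P(x)=A_j^{-1}\sum_{n=0}^2\langle P,P_{j3}^{(n)}\rangle P_{j3}^{(n)}(x)\quad\text{for all }x\in SG .$$ -/

import Mathlib

open scoped Topology
open Filter MeasureTheory

noncomputable section

namespace Gasket

/-- The three points are the vertices of a (nondegenerate) equilateral triangle. -/
def IsEquilateral (q : Fin 3 → EuclideanSpace ℝ (Fin 2)) : Prop :=
  ∃ r : ℝ, 0 < r ∧ ∀ i j, i ≠ j → dist (q i) (q j) = r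

/-- The similarity `F_i x = (x - q_i) / 2 + q_i` of the plane. -/
def contraction (q : Fin 3 → EuclideanSpace ℝ (Fin 2)) (i : Fin 3)
    (x : EuclideanSpace ℝ (Fin 2)) : EuclideanSpace ℝ (Fin 2) :=
  (1 / 2 : ℝ) • (x - q i) + q i

/-- The point `lim_m F_{ω_0} ∘ F_{ω_1} ∘ ⋯ ∘ F_{ω_m} (x)` with address `ω`,
written as an explicit series (it does not depend on `x`). -/
def coding (q : Fin 3 → EuclideanSpace ℝ (Fin 2)) (ω : ℕ → Fin 3) :
    EuclideanSpace ℝ (Fin 2) :=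
  ∑' k, ((1 / 2 : ℝ) ^ (k + 1)) • q (ω k)

/-- The Sierpinski gasket, i.e. the attractor of the three contractions, as the set of all points
with an address; see `gasket_nonempty`, `isCompact_gasket` and `gasket_eq_iUnion` below. -/
def gasket (q : Fin 3 → EuclideanSpace ℝ (Fin 2)) : Set (EuclideanSpace ℝ (Fin 2)) :=
  Set.range (coding q)

theorem norm_coding_term_le (q : Fin 3 → EuclideanSpace ℝ (Fin 2)) (ω : ℕ → Fin 3) (k : ℕ) :
    ‖((1 / 2 : ℝ) ^ (k + 1)) • q (ω k)‖ ≤ (1 / 2 : ℝ) ^ k * ((1 / 2) * ∑ i, ‖q i‖) := by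
  have h : ‖q (ω k)‖ ≤ ∑ i, ‖q i‖ :=
    Finset.single_le_sum (f := fun i => ‖q i‖) (fun i _ => norm_nonneg _) (Finset.mem_univ (ω k))
  rw [norm_smul, Real.norm_of_nonneg (by positivity), pow_succ, mul_assoc]
  gcongr

theorem summable_coding_bound (q : Fin 3 → EuclideanSpace ℝ (Fin 2)) :
    Summable fun k : ℕ => (1 / 2 : ℝ) ^ k * ((1 / 2) * ∑ i, ‖q i‖) :=
  (summable_geometric_of_lt_one (by norm_num) (by norm_num)).mul_right _

theorem summable_coding (q : Fin 3 → EuclideanSpace ℝ (Fin 2)) (ω : ℕ → Fin 3) :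
    Summable fun k => ((1 / 2 : ℝ) ^ (k + 1)) • q (ω k) :=
  Summable.of_norm_bounded (summable_coding_bound q) (norm_coding_term_le q ω)

theorem continuous_coding (q : Fin 3 → EuclideanSpace ℝ (Fin 2)) : Continuous (coding q) := by
  refine continuous_tsum (fun k => ?_) (summable_coding_bound q)
    (fun k ω => norm_coding_term_le q ω k)
  have hq : Continuous q := continuous_of_discreteTopology
  have hk : Continuous fun ω : ℕ → Fin 3 => ω k := continuous_apply k
  exact (hq.comp hk).const_smul ((1 / 2 : ℝ) ^ (k + 1))

theorem coding_cons (q : Fin 3 → EuclideanSpace ℝ (Fin 2)) (i : Fin 3) (ω : ℕ → Fin 3) :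
    coding q (fun k => Nat.casesOn k i ω) = contraction q i (coding q ω) := by
  unfold coding contraction
  rw [(summable_coding q _).tsum_eq_zero_add]
  have h : ∀ k : ℕ, ((1 / 2 : ℝ) ^ (k + 1 + 1)) • q (ω k)
      = (1 / 2 : ℝ) • (((1 / 2 : ℝ) ^ (k + 1)) • q (ω k)) := by
    intro k
    rw [smul_smul, pow_succ' _ (k + 1)]
  simp only [h]
  rw [(summable_coding q ω).tsum_const_smul]
  module

theorem coding_const (q : Fin 3 → EuclideanSpace ℝ (Fin 2)) (i : Fin 3) :
    coding q (fun _ => i) = q i := by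
  have h := coding_cons q i (fun _ => i)
  have e : (fun k : ℕ => (Nat.casesOn k i (fun _ => i) : Fin 3)) = fun _ => i := by
    funext k; cases k <;> rfl
  rw [e] at h
  unfold contraction at h
  have h2 : (1 / 2 : ℝ) • (coding q (fun _ => i) - q i) = 0 := by
    have : coding q (fun _ => i) - q i = (1 / 2 : ℝ) • (coding q (fun _ => i) - q i) := by
      nth_rewrite 1 [h]; simp
    have h3 : (1 / 2 : ℝ) • (coding q (fun _ => i) - q i)
        = (coding q (fun _ => i) - q i) - (1 / 2 : ℝ) • (coding q (fun _ => i) - q i) := by module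
    rw [h3, ← this, sub_self]
  have h4 := (smul_eq_zero.mp h2).resolve_left (by norm_num)
  exact sub_eq_zero.mp h4

theorem vertex_mem (q : Fin 3 → EuclideanSpace ℝ (Fin 2)) (i : Fin 3) : q i ∈ gasket q :=
  ⟨fun _ => i, coding_const q i⟩

theorem contraction_mem (q : Fin 3 → EuclideanSpace ℝ (Fin 2)) (i : Fin 3)
    {x : EuclideanSpace ℝ (Fin 2)} (hx : x ∈ gasket q) : contraction q i x ∈ gasket q := by
  obtain ⟨ω, rfl⟩ := hx
  exact ⟨_, coding_cons q i ω⟩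

theorem gasket_nonempty (q : Fin 3 → EuclideanSpace ℝ (Fin 2)) : (gasket q).Nonempty :=
  ⟨q 0, vertex_mem q 0⟩

theorem isCompact_gasket (q : Fin 3 → EuclideanSpace ℝ (Fin 2)) : IsCompact (gasket q) :=
  isCompact_range (continuous_coding q)

theorem gasket_eq_iUnion (q : Fin 3 → EuclideanSpace ℝ (Fin 2)) :
    gasket q = ⋃ i, contraction q i '' gasket q := by
  apply Set.Subset.antisymm
  · rintro _ ⟨ω, rfl⟩
    refine Set.mem_iUnion.mpr ⟨ω 0, coding q (fun k => ω (k + 1)), ⟨_, rfl⟩, ?_⟩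
    rw [← coding_cons]
    congr 1
    funext k; cases k <;> rfl
  · refine Set.iUnion_subset fun i => ?_
    rintro _ ⟨x, hx, rfl⟩
    exact contraction_mem q i hx

/-- The boundary point `q_i`, as a point of the gasket. -/
def vertex (q : Fin 3 → EuclideanSpace ℝ (Fin 2)) (i : Fin 3) : gasket q :=
  ⟨q i, vertex_mem q i⟩

/-- The contraction `F_i`, as a self-map of the gasket. -/
def cellMap (q : Fin 3 → EuclideanSpace ℝ (Fin 2)) (i : Fin 3) (x : gasket q) : gasket q :=
  ⟨contraction q i x, contraction_mem q i x.2⟩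

/-- `F_w = F_{w_1} ∘ ⋯ ∘ F_{w_m}`; its range is the cell `F_w(SG)` of level `|w|`. -/
def wordMap (q : Fin 3 → EuclideanSpace ℝ (Fin 2)) : List (Fin 3) → gasket q → gasket q
  | [] => id
  | i :: w => cellMap q i ∘ wordMap q w

open Classical in
/-- The vertex sets: `V_0 = {q_0, q_1, q_2}` and `V_{m+1} = ⋃ i, F_i(V_m)`. -/
def verts (q : Fin 3 → EuclideanSpace ℝ (Fin 2)) : ℕ → Finset (gasket q)
  | 0 => Finset.univ.image (vertex q)
  | m + 1 => Finset.univ.biUnion fun i => (verts q m).image (cellMap q i)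

/-- The edge relation of the graph `Γ_m`, for points of `V_m`: distinct points in a common cell
of level `m`. -/
def SameCell (q : Fin 3 → EuclideanSpace ℝ (Fin 2)) (m : ℕ) (x y : gasket q) : Prop :=
  x ≠ y ∧ ∃ w : List (Fin 3), w.length = m ∧
    x ∈ Set.range (wordMap q w) ∧ y ∈ Set.range (wordMap q w)

open Classical in
/-- The graph Laplacian `Δ_m u(x) = ∑_{y ∼_m x} (u(y) - u(x))`, used for `x ∈ V_m \ V_0`. -/
def graphLaplacian (q : Fin 3 → EuclideanSpace ℝ (Fin 2)) (m : ℕ) (u : gasket q → ℝ)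
    (x : gasket q) : ℝ :=
  ∑ y ∈ (verts q m).filter (SameCell q m x), (u y - u x)

/-- `Δ u = f`: both functions are continuous and `(3/2) 5^m Δ_m u` converges to `f`, uniformly
over the points of `V_m \ V_0`. -/
def HasLaplacian (q : Fin 3 → EuclideanSpace ℝ (Fin 2)) (u f : gasket q → ℝ) : Prop :=
  Continuous u ∧ Continuous f ∧
    ∀ ε : ℝ, 0 < ε → ∃ N : ℕ, ∀ m, N ≤ m → ∀ x ∈ verts q m, x ∉ verts q 0 →
      |3 / 2 * 5 ^ m * graphLaplacian q m u x - f x| < ε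

/-- `Δ^m u = f`. -/
def HasIterLaplacian (q : Fin 3 → EuclideanSpace ℝ (Fin 2)) :
    ℕ → (gasket q → ℝ) → (gasket q → ℝ) → Prop
  | 0, u, f => f = u
  | m + 1, u, f => ∃ g, HasIterLaplacian q m u g ∧ HasLaplacian q g f

/-- `∂_n u(q_i) = a`. -/
def HasNormalDeriv (q : Fin 3 → EuclideanSpace ℝ (Fin 2)) (u : gasket q → ℝ) (i : Fin 3)
    (a : ℝ) : Prop :=
  Tendsto (fun m : ℕ => (5 / 3 : ℝ) ^ m *
      (2 * u (vertex q i) - u ((cellMap q i)^[m] (vertex q (i + 1)))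
        - u ((cellMap q i)^[m] (vertex q (i - 1))))) atTop (𝓝 a)

/-- `∂_T u(q_i) = a`. -/
def HasTangentialDeriv (q : Fin 3 → EuclideanSpace ℝ (Fin 2)) (u : gasket q → ℝ) (i : Fin 3)
    (a : ℝ) : Prop :=
  Tendsto (fun m : ℕ => (5 : ℝ) ^ m *
      (u ((cellMap q i)^[m] (vertex q (i + 1)))
        - u ((cellMap q i)^[m] (vertex q (i - 1))))) atTop (𝓝 a)

/-- The polynomials of degree at most `j`: the solutions of `Δ^{j+1} u = 0`. -/
def polynomials (q : Fin 3 → EuclideanSpace ℝ (Fin 2)) (j : ℕ) : Set (gasket q → ℝ) :=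
  {u | HasIterLaplacian q (j + 1) u 0}

/-- `u` is the monomial `P_{ji}^{(n)}` (`i = 1, 2, 3`): a polynomial of degree at most `j` such
that, for `0 ≤ m ≤ j`, the value, the normal derivative and the tangential derivative of `Δ^m u` at
`q_n` are `δ_{mj} δ_{i1}`, `δ_{mj} δ_{i2}` and `δ_{mj} δ_{i3}`. -/
def IsMonomial (q : Fin 3 → EuclideanSpace ℝ (Fin 2)) (j i : ℕ) (n : Fin 3)
    (u : gasket q → ℝ) : Prop :=
  u ∈ polynomials q j ∧ ∀ m : ℕ, m ≤ j → ∃ f, HasIterLaplacian q m u f ∧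
    f (vertex q n) = (if m = j ∧ i = 1 then 1 else 0) ∧
    HasNormalDeriv q f n (if m = j ∧ i = 2 then 1 else 0) ∧
    HasTangentialDeriv q f n (if m = j ∧ i = 3 then 1 else 0)

/-- The uniform Bernoulli measure on addresses: independent uniform digits. -/
def addressMeasure : Measure (ℕ → Fin 3) :=
  Measure.infinitePi fun _ : ℕ => (PMF.uniformOfFintype (Fin 3)).toMeasure

/-- The natural (self-similar) probability measure `μ` on the gasket, the law of the point with
a uniformly random address. The addresses that begin with the word `w` are sent onto the cell
`F_w(SG)` and have mass `3^{-|w|}`; for an equilateral triangle two cells of the same level share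
at most one point, which is null, so that `μ(F_w(SG)) = 3^{-|w|}`. -/
def measure (q : Fin 3 → EuclideanSpace ℝ (Fin 2)) : Measure (gasket q) :=
  addressMeasure.map (Set.rangeFactorization (coding q))

instance : IsProbabilityMeasure addressMeasure := by
  unfold addressMeasure; infer_instance

instance (q : Fin 3 → EuclideanSpace ℝ (Fin 2)) : IsProbabilityMeasure (measure q) :=
  Measure.isProbabilityMeasure_map
    ((continuous_coding q).measurable.subtype_mk (h := fun ω => ⟨ω, rfl⟩)).aemeasurable

/-- The inner product `⟨u, v⟩` of `L²(SG, μ)`. -/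
def l2Inner (q : Fin 3 → EuclideanSpace ℝ (Fin 2)) (u v : gasket q → ℝ) : ℝ :=
  ∫ x, u x * v x ∂(measure q)

/-- The functions `P 0, P 1, P 2` form a tight frame, with frame bound `A`, for their span
in `L²(SG, μ)`. -/
def IsTightFrame (q : Fin 3 → EuclideanSpace ℝ (Fin 2)) (P : Fin 3 → gasket q → ℝ)
    (A : ℝ) : Prop :=
  0 < A ∧ ∀ u ∈ Submodule.span ℝ (Set.range P),
    ∑ n, l2Inner q u (P n) ^ 2 = A * l2Inner q u u

end Gasket

end

noncomputable section

namespace Gasket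

variable {q : Fin 3 → EuclideanSpace ℝ (Fin 2)}

/-! The frame statement is a consequence of the symmetry of the triangle. Uniqueness of the
monomials turns every symmetry of the gasket into a relation among them: rotations permute the `P n`
cyclically, and the reflection `k ↦ a - k` sends them to each other with a sign `-1`, because it
reverses the tangential derivative (`monomial_rotation`, `monomial_reflection`). Hence `P 0 + P 1 +
P 2` is odd under all three reflections. Its highest Laplacians are harmonic and vanish at the
vertices, so they vanish one after another, and the sum is zero (`HasIterLaplacian.eq_zero_of_odd`,
`sum_monomial`). By rotation the Gram matrix has a constant diagonal `c` and constant off-diagonal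
entries, and the zero sum forces these to be `-c / 2` (`l2Inner_monomial`). This is the Gram matrix
of three plane vectors at angles of 120 degrees: `3/2 * c` times the projection onto coefficient
vectors of mean zero. Dimension, tightness and reconstruction follow.

The analysis goes into existence and uniqueness of the monomials, with the pointwise Laplacian.
Solutions of `Δ u = f` are built by refining boundary values from a cell to its subcells. The
discrete loads are integrals of `f` against harmonic splines, so that normal derivatives cancel at
junctions and the graph Laplacians are exact averages of `f` (`hasLaplacian_dirichlet`). Conversely
`Δ u = 0` forces every graph Laplacian to vanish, which gives uniqueness
(`eq_zero_of_hasLaplacian_zero`). A harmonic function is determined by its value and two derivatives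
at one vertex, whence uniqueness of monomials. For existence one looks for odd functions that scale
by `5^{-(k+1)}` under `F_n`: such functions have the prescribed derivatives automatically, and they
can be integrated repeatedly (`IsOddScaling.exists_hasLaplacian`). -/

/-! ### Barycentric coordinates, addresses and cells. -/

theorem fin3_cases (i k : Fin 3) : k = i ∨ k = i + 1 ∨ k = i + 2 := by
  revert i k; decide

/-- The `i`-th barycentric coordinate with respect to an equilateral triangle `q`. -/
def bary (q : Fin 3 → EuclideanSpace ℝ (Fin 2)) (i : Fin 3) (x : EuclideanSpace ℝ (Fin 2)) : ℝ :=
  -- The vector is twice the altitude that ends at `q i`, hence normal to the opposite side; its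
  -- product with `q i - q (i + 1)` is `3/2` times the squared side length.
  2 / (3 * dist (q 0) (q 1) ^ 2) *
    inner ℝ (2 • (q i - q (i + 1)) - (q (i + 2) - q (i + 1))) (x - q (i + 1))

theorem bary_vertex (hq : IsEquilateral q) (i k : Fin 3) :
    bary q i (q k) = if k = i then 1 else 0 := by
  obtain ⟨r, hr, h⟩ := hq
  have h01 : dist (q 0) (q 1) = r := h 0 1 (by decide)
  have e1 : ‖q i - q (i + 1)‖ = r := by rw [← dist_eq_norm]; exact h _ _ (by clear * -; revert i; decide)
  have e2 : ‖q (i + 2) - q (i + 1)‖ = r := by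
    rw [← dist_eq_norm]; exact h _ _ (by clear * -; revert i; decide)
  have e3 : ‖q i - q (i + 2)‖ = r := by rw [← dist_eq_norm]; exact h _ _ (by clear * -; revert i; decide)
  have e4 : inner ℝ (q i - q (i + 1)) (q (i + 2) - q (i + 1)) = r ^ 2 / 2 := by
    have : ‖(q i - q (i + 1)) - (q (i + 2) - q (i + 1))‖ ^ 2 = r ^ 2 := by
      rw [sub_sub_sub_cancel_right, e3]
    rw [norm_sub_sq_real, e1, e2] at this
    linarith
  unfold bary
  rw [h01, inner_sub_left, two_smul, inner_add_left]
  rcases fin3_cases i k with rfl | rfl | rfl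
  · rw [if_pos rfl, real_inner_comm, real_inner_self_eq_norm_sq, e1, ← real_inner_comm, e4]
    field_simp; norm_num
  · rw [if_neg (by clear * -; revert i; decide)]; simp
  · rw [if_neg (by clear * -; revert i; decide), e4, real_inner_self_eq_norm_sq, e2]; ring

theorem bary_contraction (hq : IsEquilateral q) (i k : Fin 3) (x : EuclideanSpace ℝ (Fin 2)) :
    bary q i (contraction q k x) = (bary q i x + if k = i then 1 else 0) / 2 := by
  rw [← bary_vertex hq i k]
  unfold bary contraction
  have : (1 / 2 : ℝ) • (x - q k) + q k - q (i + 1)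
      = (1 / 2 : ℝ) • (x - q (i + 1)) + (1 / 2 : ℝ) • (q k - q (i + 1)) := by module
  rw [this, inner_add_right, inner_smul_right, inner_smul_right]
  ring

/-- The address of `F_i` applied to the point with address `ω`. -/
def consAddr (i : Fin 3) (ω : ℕ → Fin 3) : ℕ → Fin 3 := fun k => Nat.casesOn k i ω

@[simp] theorem consAddr_zero (i : Fin 3) (ω : ℕ → Fin 3) : consAddr i ω 0 = i := rfl
@[simp] theorem consAddr_succ (i : Fin 3) (ω : ℕ → Fin 3) (k : ℕ) :
    consAddr i ω (k + 1) = ω k := rfl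

theorem consAddr_head_tail (ω : ℕ → Fin 3) : consAddr (ω 0) (fun k => ω (k + 1)) = ω := by
  funext k; cases k <;> rfl

/-- The point of the gasket with a given address. -/
def point (q : Fin 3 → EuclideanSpace ℝ (Fin 2)) (ω : ℕ → Fin 3) : gasket q :=
  Set.rangeFactorization (coding q) ω

theorem point_consAddr (i : Fin 3) (ω : ℕ → Fin 3) :
    point q (consAddr i ω) = cellMap q i (point q ω) :=
  Subtype.ext (coding_cons q i ω)

theorem point_const (i : Fin 3) : point q (fun _ => i) = vertex q i :=
  Subtype.ext (coding_const q i)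

theorem point_surjective : Function.Surjective (point q) := Set.rangeFactorization_surjective

theorem continuous_point : Continuous (point q) := (continuous_coding q).subtype_mk _

instance : CompactSpace (gasket q) := isCompact_iff_compactSpace.mp (isCompact_gasket q)

theorem isQuotientMap_point : Topology.IsQuotientMap (point q) :=
  Topology.IsQuotientMap.of_surjective_continuous point_surjective continuous_point

theorem point_head_tail (ω : ℕ → Fin 3) :
    point q ω = cellMap q (ω 0) (point q fun k => ω (k + 1)) := by
  rw [← point_consAddr, consAddr_head_tail]

theorem exists_cellMap (x : gasket q) : ∃ i y, x = cellMap q i y := by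
  obtain ⟨ω, rfl⟩ := point_surjective x
  exact ⟨_, _, point_head_tail ω⟩

theorem cellMap_vertex (i : Fin 3) : cellMap q i (vertex q i) = vertex q i := by
  apply Subtype.ext; simp [cellMap, vertex, contraction]

theorem continuous_cellMap (i : Fin 3) : Continuous (cellMap q i) := by
  unfold cellMap contraction
  exact Continuous.subtype_mk (by fun_prop) _

theorem cellMap_injective (i : Fin 3) : Function.Injective (cellMap q i) := by
  intro x y h
  have := congrArg Subtype.val h
  simp only [cellMap, contraction, add_left_inj] at this
  have h2 := smul_right_injective (EuclideanSpace ℝ (Fin 2)) (by norm_num : (1 / 2 : ℝ) ≠ 0) this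
  exact Subtype.ext (sub_left_injective h2)

theorem dist_cellMap (i : Fin 3) (x y : gasket q) :
    dist (cellMap q i x) (cellMap q i y) = dist x y / 2 := by
  simp only [Subtype.dist_eq, cellMap, contraction, dist_eq_norm]
  rw [add_sub_add_right_eq_sub, ← smul_sub, sub_sub_sub_cancel_right, norm_smul]
  norm_num; ring

theorem dist_wordMap (w : List (Fin 3)) (x y : gasket q) :
    dist (wordMap q w x) (wordMap q w y) = dist x y / 2 ^ w.length := by
  induction w with
  | nil => simp [wordMap]
  | cons i w ih => simp only [wordMap, Function.comp, dist_cellMap, ih, List.length_cons]; ring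

theorem bary_cellMap (hq : IsEquilateral q) (i k : Fin 3) (x : gasket q) :
    bary q i (cellMap q k x) = (bary q i x + if k = i then 1 else 0) / 2 :=
  bary_contraction hq i k x

/-- The barycentric coordinates of a point are read off from its address. -/
theorem bary_coding (hq : IsEquilateral q) (i : Fin 3) (ω : ℕ → Fin 3) :
    HasSum (fun k => (1 / 2 : ℝ) ^ (k + 1) * if ω k = i then 1 else 0) (bary q i (coding q ω)) := by
  have hb : ∀ x, bary q i x = 2 / (3 * dist (q 0) (q 1) ^ 2) *
    inner ℝ (2 • (q i - q (i + 1)) - (q (i + 2) - q (i + 1))) x + bary q i 0 := by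
    intro x; unfold bary; rw [← mul_add, ← inner_add_right]; congr 2; module
  have h1 := (summable_coding q ω).hasSum
  have h2 := ((innerSL ℝ (2 • (q i - q (i + 1)) - (q (i + 2) - q (i + 1)))).hasSum h1).mul_left
    (2 / (3 * dist (q 0) (q 1) ^ 2))
  have h3 : HasSum (fun k : ℕ => (1 / 2 : ℝ) ^ (k + 1)) 1 := by
    have := hasSum_geometric_two.mul_left (1 / 2 : ℝ)
    simpa [pow_succ', mul_comm] using this
  have h4 := h2.add (h3.mul_right (bary q i 0))
  rw [hb (coding q ω)]
  rw [one_mul] at h4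
  refine h4.congr_fun fun k => ?_
  rw [← bary_vertex hq i (ω k), hb (q (ω k))]
  simp only [map_smul, innerSL_apply_apply, smul_eq_mul]
  ring

theorem bary_nonneg (hq : IsEquilateral q) (i : Fin 3) (x : gasket q) : 0 ≤ bary q i x := by
  obtain ⟨_, ω, rfl⟩ := x
  exact (bary_coding hq i ω).nonneg fun k => by positivity

theorem sum_bary_smul (hq : IsEquilateral q) (x : gasket q) :
    ∑ i, bary q i x • q i = (x : EuclideanSpace ℝ (Fin 2)) := by
  obtain ⟨_, ω, rfl⟩ := x
  have h := hasSum_sum (f := fun i k =>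
    ((1 / 2 : ℝ) ^ (k + 1) * if ω k = i then 1 else 0) • q i) (s := Finset.univ)
    fun i _ => (bary_coding hq i ω).smul_const (q i)
  refine h.unique ?_
  have h2 := (summable_coding q ω).hasSum
  refine h2.congr_fun fun k => ?_
  simp [mul_ite, ite_smul]

theorem sum_bary (hq : IsEquilateral q) (x : gasket q) : ∑ i, bary q i x = 1 := by
  obtain ⟨_, ω, rfl⟩ := x
  have h := hasSum_sum (s := Finset.univ) fun i _ => bary_coding hq i ω
  refine h.unique ?_
  have h2 := hasSum_geometric_two.mul_left (1 / 2 : ℝ)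
  norm_num at h2
  refine HasSum.congr_fun (by simpa using h2) fun k => ?_
  simp [pow_succ']

theorem ext_bary (hq : IsEquilateral q) {x y : gasket q} (h : ∀ i, bary q i x = bary q i y) :
    x = y := by
  apply Subtype.ext
  rw [← sum_bary_smul hq x, ← sum_bary_smul hq y]
  simp [h]

theorem eq_vertex_of_bary (hq : IsEquilateral q) {x : gasket q} {i : Fin 3}
    (h : 1 ≤ bary q i x) : x = vertex q i := by
  have hs := sum_bary hq x
  have h0 := fun k => bary_nonneg hq k x
  refine ext_bary hq fun k => ?_
  rw [show bary q k (vertex q i) = _ from bary_vertex hq k i]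
  have hi := Finset.sum_le_sum_of_subset_of_nonneg (Finset.subset_univ {i, k})
    fun l _ _ => h0 l
  rw [hs] at hi
  by_cases hik : i = k
  · subst hik; simp at hi; rw [if_pos rfl]; linarith
  · rw [Finset.sum_pair hik] at hi
    rw [if_neg hik]; linarith [h0 k]

theorem vertex_injective (hq : IsEquilateral q) : Function.Injective (vertex q) := by
  intro i k h
  have := congrArg (fun x : gasket q => bary q i x) h
  simp only [vertex, bary_vertex hq] at this
  by_contra hne
  rw [if_pos trivial, if_neg (Ne.symm hne)] at this
  norm_num at this

/-- Distinct cells of level one meet at most in a common vertex. -/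
theorem eq_vertex_of_cellMap_eq (hq : IsEquilateral q) {i k : Fin 3} (hik : i ≠ k)
    {x y : gasket q} (h : cellMap q i x = cellMap q k y) :
    x = vertex q k ∧ y = vertex q i := by
  -- Comparing the `i`-th coordinates gives `bary i y = bary i x + 1 ≥ 1`, which only happens at the
  -- vertex `i`; the `k`-th coordinate treats `x` in the same way.
  have h1 := congrArg (fun x : gasket q => bary q i x) h
  have h2 := congrArg (fun x : gasket q => bary q k x) h
  simp only [bary_cellMap hq, if_true, if_neg hik, if_neg (Ne.symm hik)] at h1 h2
  exact ⟨eq_vertex_of_bary hq (by linarith [bary_nonneg hq k y]),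
    eq_vertex_of_bary hq (by linarith [bary_nonneg hq i x])⟩

theorem cellMap_vertex_comm (i k : Fin 3) :
    cellMap q i (vertex q k) = cellMap q k (vertex q i) := by
  apply Subtype.ext; simp only [cellMap, vertex, contraction]; module

theorem cellMap_eq_vertex (hq : IsEquilateral q) {i k : Fin 3} {x : gasket q}
    (h : cellMap q i x = vertex q k) : i = k ∧ x = vertex q k := by
  rw [← cellMap_vertex k] at h
  by_cases hik : i = k
  · subst hik; exact ⟨rfl, cellMap_injective _ h⟩
  · exact absurd (vertex_injective hq (eq_vertex_of_cellMap_eq hq hik h).2).symm hik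

/-! ### Symmetries of the gasket. -/

/-- The symmetry of the gasket that permutes the vertices by `s`, defined through addresses. -/
def symmMap (q : Fin 3 → EuclideanSpace ℝ (Fin 2)) (s : Equiv.Perm (Fin 3)) (x : gasket q) :
    gasket q :=
  point q (s ∘ Function.surjInv point_surjective x)

theorem bary_symmMap_aux (hq : IsEquilateral q) (s : Equiv.Perm (Fin 3)) (i : Fin 3)
    (ω : ℕ → Fin 3) : bary q (s i) (point q (s ∘ ω)) = bary q i (point q ω) := by
  refine (bary_coding hq (s i) (s ∘ ω)).unique ?_
  refine HasSum.congr_fun (bary_coding hq i ω) fun k => ?_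
  simp

/-- The definition picks an arbitrary address. The choice is harmless because permuting digits
permutes barycentric coordinates, and these determine the point. -/
theorem symmMap_point (hq : IsEquilateral q) (s : Equiv.Perm (Fin 3)) (ω : ℕ → Fin 3) :
    symmMap q s (point q ω) = point q (s ∘ ω) := by
  refine ext_bary hq fun i => ?_
  obtain ⟨i, rfl⟩ := s.surjective i
  rw [symmMap, bary_symmMap_aux hq, bary_symmMap_aux hq,
    Function.surjInv_eq point_surjective (point q ω)]

theorem continuous_symmMap (hq : IsEquilateral q) (s : Equiv.Perm (Fin 3)) :
    Continuous (symmMap q s) := by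
  rw [isQuotientMap_point.continuous_iff]
  have : symmMap q s ∘ point q = fun ω => point q (s ∘ ω) := funext (symmMap_point hq s)
  rw [this]
  have hs : Continuous s := continuous_of_discreteTopology
  exact continuous_point.comp (continuous_pi fun k => hs.comp (continuous_apply k))

theorem symmMap_vertex (hq : IsEquilateral q) (s : Equiv.Perm (Fin 3)) (i : Fin 3) :
    symmMap q s (vertex q i) = vertex q (s i) := by
  rw [← point_const, symmMap_point hq, ← point_const]; rfl

theorem symmMap_cellMap (hq : IsEquilateral q) (s : Equiv.Perm (Fin 3)) (i : Fin 3)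
    (x : gasket q) : symmMap q s (cellMap q i x) = cellMap q (s i) (symmMap q s x) := by
  obtain ⟨ω, rfl⟩ := point_surjective x
  rw [← point_consAddr, symmMap_point hq, symmMap_point hq, ← point_consAddr]
  congr 1; funext k; cases k <;> rfl

theorem symmMap_symmMap (hq : IsEquilateral q) (s t : Equiv.Perm (Fin 3)) (x : gasket q) :
    symmMap q s (symmMap q t x) = symmMap q (s * t) x := by
  obtain ⟨ω, rfl⟩ := point_surjective x
  rw [symmMap_point hq, symmMap_point hq, symmMap_point hq]; rfl

theorem symmMap_one (hq : IsEquilateral q) (x : gasket q) : symmMap q 1 x = x := by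
  obtain ⟨ω, rfl⟩ := point_surjective x
  rw [symmMap_point hq]; rfl

/-! ### Small cells and density of the cell vertices. -/

theorem exists_wordMap (m : ℕ) (x : gasket q) : ∃ w y, w.length = m ∧ x = wordMap q w y := by
  induction m generalizing x with
  | zero => exact ⟨[], x, rfl, rfl⟩
  | succ m ih =>
    obtain ⟨i, y, rfl⟩ := exists_cellMap x
    obtain ⟨w, z, hw, rfl⟩ := ih y
    exact ⟨i :: w, z, by simp [hw], rfl⟩

/-- Cells of high level are small, uniformly. -/
theorem exists_osc_le {f : gasket q → ℝ} (hf : Continuous f) {ε : ℝ} (hε : 0 < ε) :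
    ∃ N : ℕ, ∀ w : List (Fin 3), N ≤ w.length → ∀ x y,
      |f (wordMap q w x) - f (wordMap q w y)| < ε := by
  obtain ⟨δ, hδ, h⟩ := Metric.uniformContinuous_iff.mp
    (CompactSpace.uniformContinuous_of_continuous hf) ε hε
  obtain ⟨C, hC⟩ := (Metric.isBounded_iff.mp (isCompact_univ (X := gasket q)).isBounded)
  obtain ⟨N, hN⟩ := exists_pow_lt_of_lt_one (show 0 < δ / (|C| + 1) by positivity)
    (by norm_num : (1 / 2 : ℝ) < 1)
  refine ⟨N, fun w hw x y => h ?_⟩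
  rw [dist_wordMap]
  have h1 : dist x y ≤ |C| + 1 := by
    linarith [hC (Set.mem_univ x) (Set.mem_univ y), le_abs_self C]
  have h2 : (1 / 2 : ℝ) ^ w.length ≤ (1 / 2 : ℝ) ^ N :=
    pow_le_pow_of_le_one (by norm_num) (by norm_num) hw
  have h3 : dist x y / 2 ^ w.length ≤ (|C| + 1) * (1 / 2 : ℝ) ^ w.length := by
    rw [one_div, inv_pow, div_eq_mul_inv]; gcongr
  have : (|C| + 1) * (1 / 2 : ℝ) ^ w.length < δ := by
    calc _ ≤ (|C| + 1) * (1 / 2 : ℝ) ^ N := by gcongr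
      _ < (|C| + 1) * (δ / (|C| + 1)) := by gcongr
      _ = δ := by field_simp
  linarith

/-- A continuous function that is nonnegative at all vertices of cells is nonnegative. -/
theorem nonneg_of_vertices {f : gasket q → ℝ} (hf : Continuous f)
    (h : ∀ w i, 0 ≤ f (wordMap q w (vertex q i))) (x : gasket q) : 0 ≤ f x := by
  by_contra! hx
  obtain ⟨N, hN⟩ := exists_osc_le hf (ε := -f x) (by linarith)
  obtain ⟨w, y, hw, rfl⟩ := exists_wordMap N x
  have := hN w hw.ge (vertex q 0) y
  have h2 := h w 0
  rw [abs_lt] at this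
  linarith

theorem eq_zero_of_vertices {f : gasket q → ℝ} (hf : Continuous f)
    (h : ∀ w i, f (wordMap q w (vertex q i)) = 0) : f = 0 := by
  funext x
  have h1 := nonneg_of_vertices hf (fun w i => (h w i).ge) x
  have h2 := nonneg_of_vertices hf.neg (fun w i => by simp [h w i]) x
  simp only [Pi.zero_apply, Pi.neg_apply] at *; linarith

/-- The ratio is that of `RefinementScheme.gauge_child`: an identity between limits is proved by
bounding its defect after `m` refinements. -/
theorem eq_zero_of_abs_le_geometric {a C : ℝ} (h : ∀ m : ℕ, |a| ≤ C * (4 / 5) ^ m) : a = 0 := by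
  have ht : Tendsto (fun m : ℕ => C * (4 / 5 : ℝ) ^ m) atTop (𝓝 (C * 0)) :=
    (tendsto_pow_atTop_nhds_zero_of_lt_one (by norm_num) (by norm_num)).const_mul C
  rw [mul_zero] at ht
  exact abs_nonpos_iff.mp (ge_of_tendsto' ht h)

/-! ### Continuous functions from refinement of boundary values. -/

/-- Rules for refining boundary data from a cell to its three subcells: the data that belong to
the state `x` are the values `val x` at the vertices, the states of the subcells are `child i x`,
and `gauge` bounds the variation. -/
structure RefinementScheme (X : Type*) where
  val : X → Fin 3 → ℝ
  child : Fin 3 → X → X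
  gauge : X → ℝ
  val_child_self : ∀ x i, val (child i x) i = val x i
  val_child_comm : ∀ x i k, val (child i x) k = val (child k x) i
  gauge_child : ∀ x i, gauge (child i x) ≤ 4 / 5 * gauge x
  abs_val_sub_le : ∀ x i k l, |val (child i x) k - val x l| ≤ gauge x

namespace RefinementScheme

variable {X : Type*} (R : RefinementScheme X)

/-- The state of the cell that consists of the addresses starting like `ω` up to level `m`. -/
def state : ℕ → X → (ℕ → Fin 3) → X
  | 0, x, _ => x
  | m + 1, x, ω => state m (R.child (ω 0) x) fun k => ω (k + 1)

/-- The change of the value at vertex `0` from level `m` to level `m + 1`. -/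
def incr (x : X) (ω : ℕ → Fin 3) (m : ℕ) : ℝ :=
  R.val (R.state (m + 1) x ω) 0 - R.val (R.state m x ω) 0

/-- The value at the point with address `ω`. -/
def limit (x : X) (ω : ℕ → Fin 3) : ℝ := R.val x 0 + ∑' m, R.incr x ω m

theorem abs_incr_le (m : ℕ) (x : X) (ω : ℕ → Fin 3) :
    |R.incr x ω m| ≤ R.gauge x * (4 / 5) ^ m := by
  induction m generalizing x ω with
  | zero => simpa [incr, state] using R.abs_val_sub_le x (ω 0) 0 0
  | succ m ih =>
    refine (ih (R.child (ω 0) x) fun k => ω (k + 1)).trans ?_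
    have := R.gauge_child x (ω 0)
    rw [pow_succ]
    nlinarith [pow_pos (by norm_num : (0 : ℝ) < 4 / 5) m]

theorem hasSum_bound (x : X) :
    HasSum (fun m : ℕ => R.gauge x * (4 / 5 : ℝ) ^ m) (R.gauge x * 5) := by
  have h := (hasSum_geometric_of_lt_one (r := (4 / 5 : ℝ)) (by norm_num) (by norm_num)).mul_left
    (R.gauge x)
  rwa [show (1 - 4 / 5 : ℝ)⁻¹ = 5 by norm_num] at h

theorem summable_incr (x : X) (ω : ℕ → Fin 3) : Summable (R.incr x ω) :=
  Summable.of_norm_bounded (R.hasSum_bound x).summable fun m => R.abs_incr_le m x ω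

theorem continuous_state (m : ℕ) (x : X) : Continuous fun ω => R.val (R.state m x ω) 0 := by
  induction m generalizing x with
  | zero => exact continuous_const (y := R.val x 0)
  | succ m ih =>
    have h : Continuous fun p : Fin 3 × (ℕ → Fin 3) =>
        R.val (R.state m (R.child p.1 x) p.2) 0 :=
      continuous_prod_of_discrete_left.mpr fun i => ih (R.child i x)
    exact h.comp (f := fun ω : ℕ → Fin 3 => (ω 0, fun k => ω (k + 1))) (by fun_prop)

theorem continuous_limit (x : X) : Continuous (R.limit x) :=
  continuous_const.add <| continuous_tsum
    (fun m => (R.continuous_state (m + 1) x).sub (R.continuous_state m x))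
    (R.hasSum_bound x).summable fun m ω => R.abs_incr_le m x ω

theorem limit_head_tail (x : X) (ω : ℕ → Fin 3) :
    R.limit x ω = R.limit (R.child (ω 0) x) fun k => ω (k + 1) := by
  unfold limit
  rw [(R.summable_incr x ω).tsum_eq_zero_add]
  simp only [incr, state]
  ring

theorem abs_limit_sub_val_le (x : X) (ω : ℕ → Fin 3) (k : Fin 3) :
    |R.limit x ω - R.val x k| ≤ 7 * R.gauge x := by
  have h1 : |∑' m, R.incr x ω m| ≤ R.gauge x * 5 :=
    by
    rw [← Real.norm_eq_abs]
    exact tsum_of_norm_bounded (R.hasSum_bound x) fun m => R.abs_incr_le m x ω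
  -- Two values of the same state are compared through a value of a child, at the cost of two
  -- gauges; with the five from the series this makes seven.
  have h2 := R.abs_val_sub_le x 0 0 0
  have h3 := R.abs_val_sub_le x 0 0 k
  have : R.limit x ω - R.val x k = ∑' m, R.incr x ω m + (R.val x 0 - R.val x k) := by
    unfold limit; ring
  rw [this]
  rw [abs_le] at *
  constructor <;> linarith

theorem limit_const (x : X) (k : Fin 3) : R.limit x (fun _ => k) = R.val x k := by
  rw [← sub_eq_zero]
  refine eq_zero_of_abs_le_geometric (C := 7 * R.gauge x) fun m => ?_
  induction m generalizing x with
  | zero => simpa using R.abs_limit_sub_val_le x _ k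
  | succ m ih =>
    rw [limit_head_tail, ← R.val_child_self x k]
    refine (ih _).trans ?_
    have := R.gauge_child x k
    rw [pow_succ]
    nlinarith [pow_pos (by norm_num : (0 : ℝ) < 4 / 5) m]

/-- Well-definedness on the gasket. While the first digits agree, they are stripped off and the
gauge contracts. Once they differ, the point is a junction, both tails are constant, and
`val_child_comm` says that the two subcells agree there. -/
theorem limit_congr (hq : IsEquilateral q) (x : X) {ω ω' : ℕ → Fin 3}
    (h : point q ω = point q ω') : R.limit x ω = R.limit x ω' := by
  rw [← sub_eq_zero]
  refine eq_zero_of_abs_le_geometric (C := 14 * R.gauge x) fun m => ?_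
  induction m generalizing x ω ω' with
  | zero =>
    have h1 := R.abs_limit_sub_val_le x ω 0
    have h2 := R.abs_limit_sub_val_le x ω' 0
    rw [abs_le] at *
    constructor <;> linarith
  | succ m ih =>
    rw [R.limit_head_tail x ω, R.limit_head_tail x ω']
    rw [point_head_tail ω, point_head_tail ω'] at h
    have hg := R.gauge_child x (ω 0)
    by_cases h0 : ω 0 = ω' 0
    · rw [← h0] at h ⊢
      refine (ih _ (cellMap_injective _ h)).trans ?_
      rw [pow_succ]
      nlinarith [pow_pos (by norm_num : (0 : ℝ) < 4 / 5) m]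
    · obtain ⟨h1, h2⟩ := eq_vertex_of_cellMap_eq hq h0 h
      -- A vertex has only one address.
      have key : ∀ (k : Fin 3) (σ : ℕ → Fin 3), point q σ = vertex q k → σ = fun _ => k := by
        intro k σ hσ
        funext l
        induction l generalizing σ with
        | zero =>
          rw [point_head_tail σ] at hσ
          exact (cellMap_eq_vertex hq hσ).1
        | succ l ihl =>
          rw [point_head_tail σ] at hσ
          exact ihl _ (cellMap_eq_vertex hq hσ).2
      rw [key _ _ h1, key _ _ h2, limit_const, limit_const, R.val_child_comm, sub_self, abs_zero]
      have : 0 ≤ R.gauge x := (abs_nonneg _).trans (R.abs_val_sub_le x 0 0 0)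
      positivity

theorem exists_limit (hq : IsEquilateral q) : ∃ U : X → gasket q → ℝ,
    (∀ x, Continuous (U x)) ∧ (∀ x k, U x (vertex q k) = R.val x k) ∧
    ∀ x i y, U x (cellMap q i y) = U (R.child i x) y := by
  have hU : ∀ x ω, R.limit x (Function.surjInv point_surjective (point q ω)) = R.limit x ω :=
    fun x ω => R.limit_congr hq x (Function.surjInv_eq point_surjective (point q ω))
  refine ⟨fun x y => R.limit x (Function.surjInv point_surjective y), fun x => ?_,
    fun x k => ?_, fun x i y => ?_⟩
  · rw [isQuotientMap_point.continuous_iff]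
    exact (R.continuous_limit x).congr fun ω => (hU x ω).symm
  · rw [← point_const]
    exact (hU x _).trans (R.limit_const x k)
  · obtain ⟨ω, rfl⟩ := point_surjective y
    rw [← point_consAddr]
    simp only [hU]
    rw [limit_head_tail]; rfl

end RefinementScheme

/-! ### Self-similarity and symmetry of the measure. -/

theorem measurable_consAddr (i : Fin 3) : Measurable (consAddr i) := by
  refine measurable_pi_lambda _ fun k => ?_
  cases k with
  | zero => exact measurable_const
  | succ k => exact measurable_pi_apply k

theorem uniform_apply_eq_sum (t : Set (Fin 3)) [DecidablePred (· ∈ t)] :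
    (PMF.uniformOfFintype (Fin 3)).toMeasure t = ∑ i, (3⁻¹ : ENNReal) * if i ∈ t then 1 else 0 := by
  rw [PMF.toMeasure_apply_fintype]
  refine Finset.sum_congr rfl fun i _ => ?_
  simp [Set.indicator_apply, PMF.uniformOfFintype_apply]

/-- Conditioning on the first digit. A product measure is determined by its values on finite boxes,
and on a box the factor at index `0` splits off. -/
theorem addressMeasure_eq_sum :
    addressMeasure = ∑ i : Fin 3, (3⁻¹ : ENNReal) • addressMeasure.map (consAddr i) := by
  classical
  symm
  refine Measure.eq_infinitePi _ fun s t ht => ?_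
  obtain ⟨N, hN⟩ : ∃ N, s ⊆ Finset.range (N + 1) :=
    ⟨s.sup id, fun k hk => Finset.mem_range_succ_iff.mpr (Finset.le_sup (f := id) hk)⟩
  -- The box is padded with full factors, so that its index set becomes an initial segment and can
  -- be shifted.
  set t' : ℕ → Set (Fin 3) := fun k => if k ∈ s then t k else Set.univ with ht'
  have hm : ∀ k, MeasurableSet (t' k) := fun k => .of_discrete
  have e1 : Set.pi (s : Set ℕ) t = Set.pi (Finset.range (N + 1) : Set ℕ) t' := by
    ext ω
    simp only [Set.mem_pi, Finset.mem_coe, ht']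
    constructor
    · intro h k _
      split_ifs with hk
      · exact h k hk
      · trivial
    · intro h k hk
      simpa [hk] using h k (hN hk)
  have e2 : ∏ k ∈ s, (PMF.uniformOfFintype (Fin 3)).toMeasure (t k)
      = ∏ k ∈ Finset.range (N + 1), (PMF.uniformOfFintype (Fin 3)).toMeasure (t' k) := by
    rw [← Finset.prod_subset hN]
    · refine Finset.prod_congr rfl fun k hk => ?_
      simp [ht', hk]
    · intro k _ hk
      simp [ht', hk]
  rw [e1, e2, Finset.prod_range_succ', uniform_apply_eq_sum, Finset.mul_sum]
  rw [Measure.finsetSum_apply]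
  refine Finset.sum_congr rfl fun i _ => ?_
  have hpi : MeasurableSet (Set.pi (Finset.range (N + 1) : Set ℕ) t') :=
    .pi (Finset.countable_toSet _) fun k _ => hm k
  rw [Measure.smul_apply, Measure.map_apply (measurable_consAddr i) hpi, smul_eq_mul]
  have e3 : consAddr i ⁻¹' Set.pi (Finset.range (N + 1) : Set ℕ) t'
      = if i ∈ t' 0 then Set.pi (Finset.range N : Set ℕ) fun k => t' (k + 1) else ∅ := by
    ext ω
    simp only [Set.mem_preimage, Set.mem_pi, Finset.mem_coe, Finset.mem_range]
    split_ifs with h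
    · simp only [Set.mem_pi, Finset.mem_coe, Finset.mem_range]
      constructor
      · intro hω k hk
        exact hω (k + 1) (by omega)
      · intro hω k hk
        cases k with
        | zero => exact h
        | succ k => exact hω k (by omega)
    · simp only [Set.mem_empty_iff_false, iff_false]
      intro hω
      exact h (hω 0 (by omega))
  rw [e3]
  split_ifs with h
  · rw [addressMeasure, Measure.infinitePi_pi _ fun k _ => hm (k + 1)]
    ring
  · simp

theorem measurable_point : Measurable (point q) :=
  ((continuous_coding q).measurable.subtype_mk (h := fun ω => ⟨ω, rfl⟩))

theorem integrable_of_continuous {f : gasket q → ℝ} (hf : Continuous f) :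
    Integrable f (measure q) :=
  hf.integrable_of_hasCompactSupport (HasCompactSupport.of_compactSpace f)

theorem integral_eq_address {f : gasket q → ℝ} (hf : Continuous f) :
    ∫ x, f x ∂measure q = ∫ ω, f (point q ω) ∂addressMeasure :=
  integral_map measurable_point.aemeasurable hf.aestronglyMeasurable

/-- Self-similarity of the measure. -/
theorem integral_eq_sum {f : gasket q → ℝ} (hf : Continuous f) :
    ∫ x, f x ∂measure q = ∑ i, (∫ x, f (cellMap q i x) ∂measure q) / 3 := by
  have hc : Continuous fun ω => f (point q ω) := hf.comp continuous_point
  rw [integral_eq_address hf]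
  conv_lhs => rw [addressMeasure_eq_sum]
  have hint : ∀ i : Fin 3, Integrable (fun ω => f (point q ω))
      ((3⁻¹ : ENNReal) • addressMeasure.map (consAddr i)) := by
    intro i
    have : IsProbabilityMeasure (addressMeasure.map (consAddr i)) :=
      Measure.isProbabilityMeasure_map (measurable_consAddr i).aemeasurable
    exact (hc.integrable_of_hasCompactSupport (HasCompactSupport.of_compactSpace _)).smul_measure
      (by simp)
  rw [integral_finsetSum_measure fun i _ => hint i]
  refine Finset.sum_congr rfl fun i _ => ?_
  rw [integral_smul_measure, integral_map (measurable_consAddr i).aemeasurable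
    hc.aestronglyMeasurable, integral_eq_address (f := fun x => f (cellMap q i x))
      (hf.comp (continuous_cellMap i))]
  simp only [point_consAddr, smul_eq_mul]
  simp
  ring

theorem map_symmMap (s : Equiv.Perm (Fin 3)) :
    addressMeasure.map (fun ω k => s (ω k)) = addressMeasure := by
  have h : (PMF.uniformOfFintype (Fin 3)).toMeasure.map s
      = (PMF.uniformOfFintype (Fin 3)).toMeasure := by
    classical
    ext t ht
    rw [Measure.map_apply .of_discrete ht, uniform_apply_eq_sum, uniform_apply_eq_sum]
    rw [← Equiv.sum_comp s fun i => (3⁻¹ : ENNReal) * if i ∈ t then 1 else 0]; rfl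
  unfold addressMeasure
  rw [Measure.infinitePi_map_pi _ fun _ => .of_discrete]
  simp only [h]

theorem integral_symmMap (hq : IsEquilateral q) (s : Equiv.Perm (Fin 3)) {f : gasket q → ℝ}
    (hf : Continuous f) : ∫ x, f (symmMap q s x) ∂measure q = ∫ x, f x ∂measure q := by
  have hs : Measurable fun (ω : ℕ → Fin 3) (k : ℕ) => s (ω k) :=
    measurable_pi_lambda _ fun k => Measurable.of_discrete.comp (measurable_pi_apply k)
  rw [integral_eq_address (f := fun x => f (symmMap q s x)) (hf.comp (continuous_symmMap hq s)),
    integral_eq_address hf]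
  conv_rhs => rw [← map_symmMap s]
  rw [integral_map (f := fun ω => f (point q ω)) hs.aemeasurable
    (hf.comp continuous_point).aestronglyMeasurable]
  simp only [symmMap_point hq]; rfl

/-- The measure charges every cell: by self-similarity a vanishing integral of a nonnegative
function vanishes on each cell, whereas `f` would exceed `f x / 2` on a small cell around a point
with `f x > 0`. -/
theorem eq_zero_of_integral_eq_zero {f : gasket q → ℝ} (hf : Continuous f) (h0 : ∀ x, 0 ≤ f x)
    (h : ∫ x, f x ∂measure q = 0) : f = 0 := by
  have hw : ∀ w : List (Fin 3), ∀ g : gasket q → ℝ, Continuous g → (∀ x, 0 ≤ g x) →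
      ∫ x, g x ∂measure q = 0 → ∫ x, g (wordMap q w x) ∂measure q = 0 := by
    intro w
    induction w with
    | nil => intro g _ _ hg; exact hg
    | cons i w ih =>
      intro g hg hg0 hgi
      refine ih (fun x => g (cellMap q i x)) (hg.comp (continuous_cellMap i)) (fun x => hg0 _) ?_
      rw [integral_eq_sum hg, Finset.sum_eq_zero_iff_of_nonneg fun k _ =>
        div_nonneg (integral_nonneg fun x => hg0 _) (by norm_num)] at hgi
      simpa using hgi i (Finset.mem_univ i)
  funext x
  by_contra hx
  have hpos : 0 < f x := lt_of_le_of_ne (h0 x) (Ne.symm hx)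
  obtain ⟨N, hN⟩ := exists_osc_le hf (half_pos hpos)
  obtain ⟨w, y, hwl, rfl⟩ := exists_wordMap N x
  have h2 := hw w f hf h0 h
  have h3 : ∫ _, f (wordMap q w y) / 2 ∂measure q ≤ ∫ z, f (wordMap q w z) ∂measure q := by
    refine integral_mono (integrable_const _) ?_ fun z => ?_
    · refine integrable_of_continuous (hf.comp ?_)
      clear * -
      induction w with
      | nil => exact continuous_id
      | cons i w ih => exact (continuous_cellMap i).comp ih
    · have := hN w hwl.ge y z
      rw [abs_lt] at this
      dsimp only; linarith
  rw [h2] at h3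
  simp at h3
  linarith

/-! ### The graphs and their Laplacians under contractions and symmetries. -/

theorem mem_verts_zero {x : gasket q} : x ∈ verts q 0 ↔ ∃ i, x = vertex q i := by
  simp [verts, eq_comm]

theorem vertex_mem_verts_zero (i : Fin 3) : vertex q i ∈ verts q 0 := mem_verts_zero.mpr ⟨i, rfl⟩

theorem mem_verts_succ {m : ℕ} {x : gasket q} :
    x ∈ verts q (m + 1) ↔ ∃ i, ∃ y ∈ verts q m, x = cellMap q i y := by
  simp [verts, eq_comm]

theorem vertex_mem_verts (m : ℕ) (i : Fin 3) : vertex q i ∈ verts q m := by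
  induction m with
  | zero => exact vertex_mem_verts_zero i
  | succ m ih => exact mem_verts_succ.mpr ⟨i, _, ih, (cellMap_vertex i).symm⟩

theorem cellMap_notMem_verts_zero (hq : IsEquilateral q) {i : Fin 3} {y : gasket q}
    (h : y ≠ vertex q i) : cellMap q i y ∉ verts q 0 := by
  rw [mem_verts_zero]
  rintro ⟨k, hk⟩
  obtain ⟨rfl, rfl⟩ := cellMap_eq_vertex hq hk
  exact h rfl

theorem cellMap_mem_interior (hq : IsEquilateral q) {m : ℕ} (i : Fin 3) {y : gasket q}
    (hy : y ∈ verts q m) (hy0 : y ∉ verts q 0) :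
    cellMap q i y ∈ verts q (m + 1) ∧ cellMap q i y ∉ verts q 0 :=
  ⟨mem_verts_succ.mpr ⟨i, y, hy, rfl⟩, cellMap_notMem_verts_zero hq fun h =>
    hy0 (h ▸ vertex_mem_verts_zero i)⟩

theorem junction_mem_interior (hq : IsEquilateral q) (m : ℕ) {i k : Fin 3} (hik : i ≠ k) :
    cellMap q i (vertex q k) ∈ verts q (m + 1) ∧ cellMap q i (vertex q k) ∉ verts q 0 :=
  ⟨mem_verts_succ.mpr ⟨i, _, vertex_mem_verts m k, rfl⟩, cellMap_notMem_verts_zero hq fun h =>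
    hik (vertex_injective hq h).symm⟩

/-- A point of `V_{m+1} \ V_0` is the image of a point of `V_m \ V_0` or a junction point. -/
theorem interior_succ_cases {m : ℕ} {x : gasket q} (hx : x ∈ verts q (m + 1))
    (hx0 : x ∉ verts q 0) : (∃ i, ∃ y ∈ verts q m, y ∉ verts q 0 ∧ x = cellMap q i y) ∨
      ∃ i k, i ≠ k ∧ x = cellMap q i (vertex q k) := by
  obtain ⟨i, y, hy, rfl⟩ := mem_verts_succ.mp hx
  by_cases h : y ∈ verts q 0
  · obtain ⟨k, rfl⟩ := mem_verts_zero.mp h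
    refine Or.inr ⟨i, k, ?_, rfl⟩
    rintro rfl
    rw [cellMap_vertex] at hx0
    exact hx0 h
  · exact Or.inl ⟨i, y, hy, h, rfl⟩

theorem sameCell_zero {x y : gasket q} : SameCell q 0 x y ↔ x ≠ y := by
  constructor
  · exact fun h => h.1
  · exact fun h => ⟨h, [], rfl, ⟨x, rfl⟩, ⟨y, rfl⟩⟩

theorem sameCell_succ {m : ℕ} {x z : gasket q} : SameCell q (m + 1) x z ↔
    ∃ i y y', x = cellMap q i y ∧ z = cellMap q i y' ∧ SameCell q m y y' := by
  constructor
  · rintro ⟨hne, w, hw, ⟨a, rfl⟩, ⟨b, rfl⟩⟩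
    cases w with
    | nil => simp at hw
    | cons i w =>
      refine ⟨i, wordMap q w a, wordMap q w b, rfl, rfl, ?_, w, by simpa using hw, ⟨a, rfl⟩,
        ⟨b, rfl⟩⟩
      intro h
      exact hne (congrArg (cellMap q i) h)
  · rintro ⟨i, _, _, rfl, rfl, hne, w, hw, ⟨a, rfl⟩, ⟨b, rfl⟩⟩
    exact ⟨fun h => hne (cellMap_injective i h), i :: w, by simp [hw], ⟨a, rfl⟩, ⟨b, rfl⟩⟩

open Classical in
/-- The neighbours of `x` in the graph of level `m`. -/
def nbrs (q : Fin 3 → EuclideanSpace ℝ (Fin 2)) (m : ℕ) (x : gasket q) : Finset (gasket q) :=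
  (verts q m).filter (SameCell q m x)

theorem mem_nbrs {m : ℕ} {x y : gasket q} : y ∈ nbrs q m x ↔ y ∈ verts q m ∧ SameCell q m x y := by
  simp [nbrs]

theorem graphLaplacian_eq (m : ℕ) (u : gasket q → ℝ) (x : gasket q) :
    graphLaplacian q m u x = ∑ y ∈ nbrs q m x, (u y - u x) := rfl

theorem mem_nbrs_succ (hq : IsEquilateral q) {m : ℕ} {x z : gasket q} : z ∈ nbrs q (m + 1) x ↔
    ∃ i y y', x = cellMap q i y ∧ z = cellMap q i y' ∧ y' ∈ nbrs q m y := by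
  simp only [mem_nbrs]
  rw [sameCell_succ]
  constructor
  · rintro ⟨hz, i, y, y', rfl, rfl, h⟩
    refine ⟨i, y, y', rfl, rfl, ?_, h⟩
    obtain ⟨k, y'', hy'', e⟩ := mem_verts_succ.mp hz
    by_cases hik : i = k
    · subst hik
      rwa [cellMap_injective i e]
    · rw [(eq_vertex_of_cellMap_eq hq hik e).1]
      exact vertex_mem_verts m k
  · rintro ⟨i, y, y', rfl, rfl, hy', h⟩
    exact ⟨mem_verts_succ.mpr ⟨i, y', hy', rfl⟩, i, y, y', rfl, rfl, h⟩

/-- The hypothesis excludes only the corners shared with other cells, so all neighbours lie in the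
cell `i`. The outer corner `y = vertex q i` is allowed. -/
theorem graphLaplacian_cellMap (hq : IsEquilateral q) (m : ℕ) (u : gasket q → ℝ) (i : Fin 3)
    {y : gasket q} (hy : ∀ k, k ≠ i → y ≠ vertex q k) :
    graphLaplacian q (m + 1) u (cellMap q i y)
      = graphLaplacian q m (fun x => u (cellMap q i x)) y := by
  classical
  have h : nbrs q (m + 1) (cellMap q i y) = (nbrs q m y).image (cellMap q i) := by
    ext z
    rw [mem_nbrs_succ hq, Finset.mem_image]
    constructor
    · rintro ⟨k, y1, y2, e1, rfl, h⟩
      by_cases hik : i = k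
      · subst hik
        rw [cellMap_injective i e1]
        exact ⟨y2, h, rfl⟩
      · exact absurd (eq_vertex_of_cellMap_eq hq hik e1).1 (hy k (Ne.symm hik))
    · rintro ⟨y2, h, rfl⟩
      exact ⟨i, y, y2, rfl, rfl, h⟩
  rw [graphLaplacian_eq, h, Finset.sum_image fun a _ b _ e => cellMap_injective i e]
  rfl

theorem graphLaplacian_cellMap_interior (hq : IsEquilateral q) (m : ℕ) (u : gasket q → ℝ)
    (i : Fin 3) {y : gasket q} (hy : y ∉ verts q 0) :
    graphLaplacian q (m + 1) u (cellMap q i y)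
      = graphLaplacian q m (fun x => u (cellMap q i x)) y :=
  graphLaplacian_cellMap hq m u i fun k _ h => hy (h ▸ vertex_mem_verts_zero k)

theorem graphLaplacian_vertex_succ (hq : IsEquilateral q) (m : ℕ) (u : gasket q → ℝ)
    (i : Fin 3) : graphLaplacian q (m + 1) u (vertex q i)
      = graphLaplacian q m (fun x => u (cellMap q i x)) (vertex q i) := by
  rw [← graphLaplacian_cellMap hq m u i fun k hk h => hk (vertex_injective hq h).symm,
    cellMap_vertex]

/-- A junction lies in exactly two cells of level one, which share no other point, so its neighbours
split into two disjoint groups. -/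
theorem graphLaplacian_junction (hq : IsEquilateral q) (m : ℕ) (u : gasket q → ℝ) {i k : Fin 3}
    (hik : i ≠ k) : graphLaplacian q (m + 1) u (cellMap q i (vertex q k))
      = graphLaplacian q m (fun x => u (cellMap q i x)) (vertex q k)
        + graphLaplacian q m (fun x => u (cellMap q k x)) (vertex q i) := by
  classical
  have h : nbrs q (m + 1) (cellMap q i (vertex q k))
      = (nbrs q m (vertex q k)).image (cellMap q i)
        ∪ (nbrs q m (vertex q i)).image (cellMap q k) := by
    ext z
    rw [mem_nbrs_succ hq, Finset.mem_union, Finset.mem_image, Finset.mem_image]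
    constructor
    · rintro ⟨l, y1, y2, e1, rfl, h⟩
      by_cases hil : i = l
      · subst hil
        rw [← cellMap_injective i e1] at h
        exact Or.inl ⟨y2, h, rfl⟩
      · obtain ⟨e2, e3⟩ := eq_vertex_of_cellMap_eq hq hil e1
        obtain rfl := vertex_injective hq e2
        rw [e3] at h
        exact Or.inr ⟨y2, h, rfl⟩
    · rintro (⟨y2, h, rfl⟩ | ⟨y2, h, rfl⟩)
      · exact ⟨i, _, y2, rfl, rfl, h⟩
      · exact ⟨k, _, y2, cellMap_vertex_comm i k, rfl, h⟩
  have hd : Disjoint ((nbrs q m (vertex q k)).image (cellMap q i))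
      ((nbrs q m (vertex q i)).image (cellMap q k)) := by
    rw [Finset.disjoint_left]
    intro z h1 h2
    obtain ⟨a, ha, rfl⟩ := Finset.mem_image.mp h1
    obtain ⟨b, hb, e⟩ := Finset.mem_image.mp h2
    exact (mem_nbrs.mp ha).2.1 (eq_vertex_of_cellMap_eq hq hik e.symm).1.symm
  rw [graphLaplacian_eq, h, Finset.sum_union hd,
    Finset.sum_image fun a _ b _ e => cellMap_injective i e,
    Finset.sum_image fun a _ b _ e => cellMap_injective k e]
  simp only [graphLaplacian_eq, cellMap_vertex_comm k i]

theorem graphLaplacian_zero_vertex (hq : IsEquilateral q) (u : gasket q → ℝ) (k : Fin 3) :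
    graphLaplacian q 0 u (vertex q k) = ∑ i, (u (vertex q i) - u (vertex q k)) := by
  classical
  have h : nbrs q 0 (vertex q k) = (Finset.univ.erase k).image (vertex q) := by
    ext z
    simp only [mem_nbrs, mem_verts_zero, sameCell_zero, Finset.mem_image, Finset.mem_erase,
      Finset.mem_univ, and_true]
    constructor
    · rintro ⟨⟨i, rfl⟩, h⟩
      exact ⟨i, fun e => h (e ▸ rfl), rfl⟩
    · rintro ⟨i, h, rfl⟩
      exact ⟨⟨i, rfl⟩, fun e => h (vertex_injective hq e).symm⟩
  rw [graphLaplacian_eq, h, Finset.sum_image fun a _ b _ e => vertex_injective hq e,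
    ← Finset.add_sum_erase _ _ (Finset.mem_univ k), sub_self, zero_add]

theorem graphLaplacian_add (m : ℕ) (u v : gasket q → ℝ) (x : gasket q) :
    graphLaplacian q m (u + v) x = graphLaplacian q m u x + graphLaplacian q m v x := by
  simp only [graphLaplacian, ← Finset.sum_add_distrib, Pi.add_apply]
  exact Finset.sum_congr rfl fun y _ => by ring

theorem graphLaplacian_smul (m : ℕ) (c : ℝ) (u : gasket q → ℝ) (x : gasket q) :
    graphLaplacian q m (c • u) x = c * graphLaplacian q m u x := by
  simp only [graphLaplacian, Finset.mul_sum, Pi.smul_apply, smul_eq_mul]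
  exact Finset.sum_congr rfl fun y _ => by ring

theorem symmMap_mem_verts (hq : IsEquilateral q) (s : Equiv.Perm (Fin 3)) {m : ℕ} {x : gasket q}
    (hx : x ∈ verts q m) : symmMap q s x ∈ verts q m := by
  induction m generalizing x with
  | zero =>
    obtain ⟨i, rfl⟩ := mem_verts_zero.mp hx
    rw [symmMap_vertex hq]
    exact vertex_mem_verts_zero _
  | succ m ih =>
    obtain ⟨i, y, hy, rfl⟩ := mem_verts_succ.mp hx
    rw [symmMap_cellMap hq]
    exact mem_verts_succ.mpr ⟨_, _, ih hy, rfl⟩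

theorem symmMap_inv_symmMap (hq : IsEquilateral q) (s : Equiv.Perm (Fin 3)) (x : gasket q) :
    symmMap q s⁻¹ (symmMap q s x) = x := by
  rw [symmMap_symmMap hq, inv_mul_cancel, symmMap_one hq]

theorem symmMap_symmMap_inv (hq : IsEquilateral q) (s : Equiv.Perm (Fin 3)) (x : gasket q) :
    symmMap q s (symmMap q s⁻¹ x) = x := by
  rw [symmMap_symmMap hq, mul_inv_cancel, symmMap_one hq]

theorem sameCell_symmMap (hq : IsEquilateral q) (s : Equiv.Perm (Fin 3)) {m : ℕ} {x y : gasket q}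
    (h : SameCell q m x y) : SameCell q m (symmMap q s x) (symmMap q s y) := by
  induction m generalizing x y with
  | zero =>
    rw [sameCell_zero] at *
    exact fun e => h (by rw [← symmMap_inv_symmMap hq s x, e, symmMap_inv_symmMap hq])
  | succ m ih =>
    obtain ⟨i, a, b, rfl, rfl, hab⟩ := sameCell_succ.mp h
    exact sameCell_succ.mpr ⟨s i, _, _, symmMap_cellMap hq s i a, symmMap_cellMap hq s i b, ih hab⟩

theorem graphLaplacian_symmMap (hq : IsEquilateral q) (s : Equiv.Perm (Fin 3)) (m : ℕ)
    (u : gasket q → ℝ) (x : gasket q) :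
    graphLaplacian q m (fun y => u (symmMap q s y)) x = graphLaplacian q m u (symmMap q s x) := by
  simp only [graphLaplacian_eq]
  refine Finset.sum_nbij' (symmMap q s) (symmMap q s⁻¹) ?_ ?_ ?_ ?_ ?_
  · intro y hy
    rw [mem_nbrs] at *
    exact ⟨symmMap_mem_verts hq s hy.1, sameCell_symmMap hq s hy.2⟩
  · intro y hy
    rw [mem_nbrs] at *
    have := sameCell_symmMap hq s⁻¹ hy.2
    rw [symmMap_inv_symmMap hq] at this
    exact ⟨symmMap_mem_verts hq _ hy.1, this⟩
  · exact fun y _ => symmMap_inv_symmMap hq s y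
  · exact fun y _ => symmMap_symmMap_inv hq s y
  · exact fun _ _ => rfl

/-! ### The refinement scheme of the Dirichlet problem. -/

/-- The function `f ∘ F_i`. -/
def restrict (i : Fin 3) (f : C(gasket q, ℝ)) : C(gasket q, ℝ) :=
  f.comp ⟨cellMap q i, continuous_cellMap i⟩

@[simp] theorem restrict_apply (i : Fin 3) (f : C(gasket q, ℝ)) (x : gasket q) :
    restrict i f x = f (cellMap q i x) := rfl

theorem restrict_smul (i : Fin 3) (c : ℝ) (f : C(gasket q, ℝ)) :
    restrict i (c • f) = c • restrict i f := rfl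

theorem restrict_iterate_smul (i : Fin 3) (c : ℝ) (f : C(gasket q, ℝ)) (m : ℕ) :
    (restrict i)^[m] (c • f) = c • (restrict i)^[m] f := by
  induction m generalizing f with
  | zero => rfl
  | succ m ih => rw [Function.iterate_succ_apply, restrict_smul, ih, Function.iterate_succ_apply]

theorem restrict_iterate_apply (i : Fin 3) (f : C(gasket q, ℝ)) (m : ℕ) (x : gasket q) :
    (restrict i)^[m] f x = f (wordMap q (List.replicate m i) x) := by
  induction m generalizing f with
  | zero => rfl
  | succ m ih => rw [Function.iterate_succ_apply, ih]; rfl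

theorem norm_restrict_le (i : Fin 3) (f : C(gasket q, ℝ)) : ‖restrict i f‖ ≤ ‖f‖ :=
  (ContinuousMap.norm_le _ (norm_nonneg _)).mpr fun _ => f.norm_coe_le_norm _

/-- The oscillation of boundary values. -/
def osc (b : Fin 3 → ℝ) : ℝ := |b 0 - b 1| + |b 1 - b 2| + |b 2 - b 0|

/-- The boundary values on the subcell `i`, when the values at the midpoints solve the three
equations for the graph Laplacian of level one with right-hand sides `d`. -/
def subdivide (b : Fin 3 → ℝ) (d : Fin 3 → Fin 3 → ℝ) (i k : Fin 3) : ℝ :=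
  if k = i then b i
  -- The equation at the midpoint `m` of `i` and `k` reads `b i + b k + S - 5 m = d i k`, with `S`
  -- the sum of the three midpoint values. Adding the three equations gives `S = b 0 + b 1 + b 2 -
  -- (d 0 1 + d 1 2 + d 2 0) / 2`.
  else (b i + b k + (b 0 + b 1 + b 2) - (d 0 1 + d 1 2 + d 2 0) / 2 - d i k) / 5

theorem subdivide_gauge_aux (a b c d e f M : ℝ) (hd : |d| ≤ 2 / 5 * M) (he : |e| ≤ 2 / 5 * M)
    (hf : |f| ≤ 2 / 5 * M) :
    |a - (a + b + (a + b + c) - (d + e + f) / 2 - d) / 5|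
      + |(a + b + (a + b + c) - (d + e + f) / 2 - d) / 5
        - (a + c + (a + b + c) - (d + e + f) / 2 - f) / 5|
      + |(a + c + (a + b + c) - (d + e + f) / 2 - f) / 5 - a|
      ≤ 3 / 5 * (|a - b| + |b - c| + |c - a|) + 6 / 5 * M := by
  have h1 := abs_le.mp (le_refl |a - b|)
  have h2 := abs_le.mp (le_refl |b - c|)
  have h3 := abs_le.mp (le_refl |c - a|)
  rw [abs_le] at hd he hf
  have e1 : |a - (a + b + (a + b + c) - (d + e + f) / 2 - d) / 5|
      ≤ (2 * |a - b| + |c - a|) / 5 + 2 / 5 * M := by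
    rw [abs_le]; constructor <;> linarith
  have e2 : |(a + b + (a + b + c) - (d + e + f) / 2 - d) / 5
        - (a + c + (a + b + c) - (d + e + f) / 2 - f) / 5| ≤ |b - c| / 5 + 2 / 5 * M := by
    rw [abs_le]; constructor <;> linarith
  have e3 : |(a + c + (a + b + c) - (d + e + f) / 2 - f) / 5 - a|
      ≤ (2 * |c - a| + |a - b|) / 5 + 2 / 5 * M := by
    rw [abs_le]; constructor <;> linarith
  linarith [abs_nonneg (b - c)]

theorem osc_subdivide_le {b : Fin 3 → ℝ} {d : Fin 3 → Fin 3 → ℝ} (hs : ∀ i k, d i k = d k i) {M : ℝ}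
    (hd : ∀ i k, |d i k| ≤ 2 / 5 * M) (i : Fin 3) :
    osc (subdivide b d i) ≤ 3 / 5 * osc b + 6 / 5 * M := by
  have h0 := subdivide_gauge_aux (b 0) (b 1) (b 2) (d 0 1) (d 1 2) (d 2 0) M (hd _ _) (hd _ _) (hd _ _)
  have h1 := subdivide_gauge_aux (b 1) (b 2) (b 0) (d 1 2) (d 2 0) (d 0 1) M (hd _ _) (hd _ _) (hd _ _)
  have h2 := subdivide_gauge_aux (b 2) (b 0) (b 1) (d 2 0) (d 0 1) (d 1 2) M (hd _ _) (hd _ _) (hd _ _)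
  unfold osc subdivide
  fin_cases i
  · simp [hs 0 2]; ring_nf at h0 ⊢; exact h0
  · simp [hs 1 0]; ring_nf at h1 ⊢; linarith
  · simp [hs 2 1]; ring_nf at h2 ⊢; linarith

theorem abs_subdivide_sub_le {b : Fin 3 → ℝ} {d : Fin 3 → Fin 3 → ℝ} {M : ℝ} (hM : 0 ≤ M)
    (hd : ∀ i k, |d i k| ≤ 2 / 5 * M) (i k l : Fin 3) :
    |subdivide b d i k - b l| ≤ osc b + 2 * M := by
  have h1 := abs_le.mp (le_refl |b 0 - b 1|)
  have h2 := abs_le.mp (le_refl |b 1 - b 2|)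
  have h3 := abs_le.mp (le_refl |b 2 - b 0|)
  have hd1 := abs_le.mp (hd 0 1)
  have hd2 := abs_le.mp (hd 1 2)
  have hd3 := abs_le.mp (hd 2 0)
  have hd4 := abs_le.mp (hd i k)
  unfold osc subdivide
  rw [abs_le]
  fin_cases i <;> fin_cases k <;> fin_cases l <;> simp at hd4 ⊢ <;> constructor <;> linarith

variable (q) in
/-- Three functionals on continuous functions, bounded by the supremum norm. -/
structure Moments where
  toFun : Fin 3 → C(gasket q, ℝ) → ℝ
  bound : ∀ k f, |toFun k f| ≤ ‖f‖

/-- The right-hand side of the equation at the junction point of the subcells `i` and `k`. -/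
def Moments.load (L : Moments q) (f : C(gasket q, ℝ)) (i k : Fin 3) : ℝ :=
  (L.toFun k (restrict i f) + L.toFun i (restrict k f)) / 5

theorem Moments.load_comm (L : Moments q) (f : C(gasket q, ℝ)) (i k : Fin 3) :
    L.load f i k = L.load f k i := by
  unfold Moments.load; rw [add_comm]

theorem Moments.abs_load_le (L : Moments q) (f : C(gasket q, ℝ)) (i k : Fin 3) :
    |L.load f i k| ≤ 2 / 5 * ‖f‖ := by
  have h1 := abs_le.mp ((L.bound k (restrict i f)).trans (norm_restrict_le i f))
  have h2 := abs_le.mp ((L.bound i (restrict k f)).trans (norm_restrict_le k f))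
  unfold Moments.load
  rw [abs_le]; constructor <;> linarith

/-- The refinement scheme for the Dirichlet problem `Δ u = f`. -/
def Moments.scheme (L : Moments q) : RefinementScheme ((Fin 3 → ℝ) × C(gasket q, ℝ)) where
  val p := p.1
  -- The Laplacian of `u ∘ F_i` is `1/5` of `(Δ u) ∘ F_i`.
  child i p := (subdivide p.1 (L.load p.2) i, (1 / 5 : ℝ) • restrict i p.2)
  -- With this weight one refinement gives at most `3/5 osc + 6/5 M + 2/5 M`, where `M` is the norm
  -- of the right-hand side, and `8/5 M` is exactly `4/5` of `2 M`.
  gauge p := osc p.1 + 2 * ‖p.2‖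
  val_child_self p i := by simp [subdivide]
  val_child_comm p i k := by
    by_cases h : k = i
    · rw [h]
    · simp only [subdivide, if_neg h, if_neg (Ne.symm h), L.load_comm p.2 k i]; ring
  gauge_child p i := by
    have h1 := osc_subdivide_le (b := p.1) (L.load_comm p.2) (L.abs_load_le p.2) i
    have h2 := norm_restrict_le i p.2
    have h0 : 0 ≤ osc p.1 := by unfold osc; positivity
    have h3 : ‖(1 / 5 : ℝ) • restrict i p.2‖ = 1 / 5 * ‖restrict i p.2‖ := by
      rw [norm_smul]; norm_num
    dsimp only
    rw [h3]
    linarith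
  abs_val_sub_le p i k l := abs_subdivide_sub_le (norm_nonneg _) (L.abs_load_le p.2) i k l

/-- The function with boundary values `b` and Laplacian `f` produced by the refinement scheme. -/
def Moments.solve (hq : IsEquilateral q) (L : Moments q) (b : Fin 3 → ℝ) (f : C(gasket q, ℝ)) :
    gasket q → ℝ :=
  Classical.choose (L.scheme.exists_limit hq) (b, f)

theorem Moments.continuous_solve (hq : IsEquilateral q) (L : Moments q) (b : Fin 3 → ℝ)
    (f : C(gasket q, ℝ)) : Continuous (L.solve hq b f) :=
  (Classical.choose_spec (L.scheme.exists_limit hq)).1 (b, f)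

theorem Moments.solve_vertex (hq : IsEquilateral q) (L : Moments q) (b : Fin 3 → ℝ)
    (f : C(gasket q, ℝ)) (k : Fin 3) : L.solve hq b f (vertex q k) = b k :=
  (Classical.choose_spec (L.scheme.exists_limit hq)).2.1 (b, f) k

theorem Moments.solve_cellMap (hq : IsEquilateral q) (L : Moments q) (b : Fin 3 → ℝ)
    (f : C(gasket q, ℝ)) (i : Fin 3) (y : gasket q) : L.solve hq b f (cellMap q i y)
      = L.solve hq (subdivide b (L.load f) i) ((1 / 5 : ℝ) • restrict i f) y :=
  (Classical.choose_spec (L.scheme.exists_limit hq)).2.2 (b, f) i y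

/-! ### Harmonic functions and the integrals against them. -/

/-- The harmonic function with boundary values `b`. -/
def harmonic (hq : IsEquilateral q) (b : Fin 3 → ℝ) : gasket q → ℝ :=
  -- Zero functionals give zero loads. The scheme is kept general in its functionals because the
  -- ones for `Δ u = f` are integrals against harmonic functions, which have to exist beforehand.
  Moments.solve hq ⟨fun _ _ => 0, by simp⟩ b 0

theorem continuous_harmonic (hq : IsEquilateral q) (b : Fin 3 → ℝ) : Continuous (harmonic hq b) :=
  Moments.continuous_solve hq _ b 0

theorem harmonic_vertex (hq : IsEquilateral q) (b : Fin 3 → ℝ) (k : Fin 3) :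
    harmonic hq b (vertex q k) = b k := Moments.solve_vertex hq _ b 0 k

theorem harmonic_cellMap (hq : IsEquilateral q) (b : Fin 3 → ℝ) (i : Fin 3) (y : gasket q) :
    harmonic hq b (cellMap q i y) = harmonic hq (subdivide b 0 i) y := by
  unfold harmonic
  rw [Moments.solve_cellMap]
  congr 1
  · congr 1
    funext i k
    simp [Moments.load]
  · ext; simp

theorem harmonic_nonneg (hq : IsEquilateral q) {b : Fin 3 → ℝ} (hb : ∀ i, 0 ≤ b i)
    (x : gasket q) : 0 ≤ harmonic hq b x := by
  refine nonneg_of_vertices (continuous_harmonic hq b) (fun w i => ?_) x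
  induction w generalizing b with
  | nil => exact (hb i).trans_eq (harmonic_vertex hq b i).symm
  | cons k w ih =>
    refine (ih (b := subdivide b 0 k) fun l => ?_).trans_eq (harmonic_cellMap hq b k _).symm
    have := hb 0
    have := hb 1
    have := hb 2
    have := hb k
    have := hb l
    unfold subdivide
    split_ifs
    · assumption
    · simp only [Pi.zero_apply]; linarith

/-- The harmonic function that is `1` at `q_k` and `0` at the other two vertices. -/
def hat (hq : IsEquilateral q) (k : Fin 3) : gasket q → ℝ := harmonic hq (Pi.single k 1)

theorem continuous_hat (hq : IsEquilateral q) (k : Fin 3) : Continuous (hat hq k) :=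
  continuous_harmonic hq _

theorem subdivide_eq_sum (b : Fin 3 → ℝ) (i k : Fin 3) :
    subdivide b 0 i k = ∑ l, b l * subdivide (Pi.single l 1) 0 i k := by
  unfold subdivide
  rw [Fin.sum_univ_three]
  fin_cases i <;> fin_cases k <;> simp <;> ring

theorem harmonic_eq_sum (hq : IsEquilateral q) (b : Fin 3 → ℝ) (x : gasket q) :
    harmonic hq b x = ∑ k, b k * hat hq k x := by
  have h : (fun x => harmonic hq b x - ∑ k, b k * hat hq k x) = 0 := by
    refine eq_zero_of_vertices ?_ fun w i => ?_
    · exact (continuous_harmonic hq b).sub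
        (continuous_finsetSum _ fun k _ => continuous_const.mul (continuous_hat hq k))
    · rw [sub_eq_zero]
      induction w generalizing b with
      | nil => simp [wordMap, hat, harmonic_vertex, Pi.single_apply]
      | cons j w ih =>
        simp only [wordMap, Function.comp, hat, harmonic_cellMap]
        rw [ih]
        simp_rw [ih (subdivide (Pi.single _ 1) 0 j), Finset.mul_sum]
        rw [Finset.sum_comm]
        refine Finset.sum_congr rfl fun k _ => ?_
        rw [subdivide_eq_sum, Finset.sum_mul]
        exact Finset.sum_congr rfl fun l _ => by ring
  exact sub_eq_zero.mp (congrFun h x)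

theorem hat_cellMap (hq : IsEquilateral q) (k i : Fin 3) (x : gasket q) :
    hat hq k (cellMap q i x) = ∑ l, subdivide (Pi.single k 1) 0 i l * hat hq l x := by
  rw [hat, harmonic_cellMap, harmonic_eq_sum]

theorem hat_nonneg (hq : IsEquilateral q) (k : Fin 3) (x : gasket q) : 0 ≤ hat hq k x :=
  harmonic_nonneg hq (fun i => by rw [Pi.single_apply]; split_ifs <;> norm_num) x

theorem sum_hat (hq : IsEquilateral q) (x : gasket q) : ∑ k, hat hq k x = 1 := by
  have h : (fun x => harmonic hq 1 x - 1) = 0 := by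
    refine eq_zero_of_vertices ((continuous_harmonic hq 1).sub continuous_const) fun w i => ?_
    rw [sub_eq_zero]
    induction w with
    | nil => exact harmonic_vertex hq 1 i
    | cons j w ih =>
      have : subdivide 1 0 j = 1 := by
        funext k; unfold subdivide; simp only [Pi.one_apply, Pi.zero_apply]; split_ifs <;> norm_num
      simp only [wordMap, Function.comp, harmonic_cellMap, this]
      exact ih
  have h2 := sub_eq_zero.mp (congrFun h x)
  rw [harmonic_eq_sum] at h2
  simpa using h2

theorem hat_le_one (hq : IsEquilateral q) (k : Fin 3) (x : gasket q) : hat hq k x ≤ 1 := by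
  rw [← sum_hat hq x]
  exact Finset.single_le_sum (f := fun k => hat hq k x) (fun k _ => hat_nonneg hq k x)
    (Finset.mem_univ k)

theorem integrable_hat_mul (hq : IsEquilateral q) (k : Fin 3) (f : C(gasket q, ℝ)) :
    Integrable (fun x => hat hq k x * f x) (measure q) :=
  integrable_of_continuous ((continuous_hat hq k).mul f.continuous)

/-- The integrals against the three harmonic functions `hat`. -/
def moments (hq : IsEquilateral q) : Moments q where
  toFun k f := ∫ x, hat hq k x * f x ∂measure q
  bound k f := by
    have h := norm_integral_le_of_norm_le_const (μ := measure q) (C := ‖f‖)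
      (f := fun x => hat hq k x * f x) (ae_of_all _ fun x => by
        rw [norm_mul, Real.norm_of_nonneg (hat_nonneg hq k x)]
        exact (mul_le_of_le_one_left (norm_nonneg _) (hat_le_one hq k x)).trans
          (f.norm_coe_le_norm x))
    simpa using h

theorem moments_apply (hq : IsEquilateral q) (k : Fin 3) (f : C(gasket q, ℝ)) :
    (moments hq).toFun k f = ∫ x, hat hq k x * f x ∂measure q := rfl

theorem moments_smul (hq : IsEquilateral q) (k : Fin 3) (c : ℝ) (f : C(gasket q, ℝ)) :
    (moments hq).toFun k (c • f) = c * (moments hq).toFun k f := by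
  simp only [moments_apply, ← integral_const_mul, ContinuousMap.smul_apply, smul_eq_mul]
  congr 1; funext x; ring

/-- On the cell `i` a harmonic function is again harmonic, with boundary values given by
`subdivide`. -/
theorem moments_self_similar (hq : IsEquilateral q) (k : Fin 3) (f : C(gasket q, ℝ)) :
    (moments hq).toFun k f = ∑ i, (∑ l, subdivide (Pi.single k 1) 0 i l *
      (moments hq).toFun l (restrict i f)) / 3 := by
  rw [moments_apply, integral_eq_sum (f := fun x => hat hq k x * f x)
    ((continuous_hat hq k).mul f.continuous)]
  refine Finset.sum_congr rfl fun i _ => ?_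
  congr 1
  simp only [hat_cellMap, Finset.sum_mul, moments_apply, ← integral_const_mul]
  rw [integral_finsetSum]
  · refine Finset.sum_congr rfl fun l _ => ?_
    congr 1; funext x; simp only [restrict_apply]; ring
  · intro l _
    exact integrable_of_continuous ((continuous_const.mul (continuous_hat hq l)).mul
      (f.continuous.comp (continuous_cellMap i)))

theorem moments_one (hq : IsEquilateral q) (k : Fin 3) : (moments hq).toFun k 1 = 1 / 3 := by
  have hr : ∀ i, restrict i (1 : C(gasket q, ℝ)) = 1 := fun _ => rfl
  have hsum : ∑ k, (moments hq).toFun k 1 = 1 := by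
    simp only [moments_apply]
    rw [← integral_finsetSum _ fun k _ => integrable_hat_mul hq k 1]
    simp only [ContinuousMap.one_apply, mul_one, sum_hat]
    simp
  -- For the constant function self-similarity is a linear relation among the three integrals;
  -- together with their total `1` it fixes each of them.
  have h := moments_self_similar hq k 1
  simp only [hr, subdivide, Fin.sum_univ_three] at h hsum
  fin_cases k <;> simp at h ⊢ <;> linarith

theorem integral_hat (hq : IsEquilateral q) (k : Fin 3) : ∫ x, hat hq k x ∂measure q = 1 / 3 := by
  rw [← moments_one hq k, moments_apply]; simp

theorem abs_moments_sub_le (hq : IsEquilateral q) (k : Fin 3) (f : C(gasket q, ℝ)) {c ε : ℝ}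
    (h : ∀ x, |f x - c| ≤ ε) : |(moments hq).toFun k f - c / 3| ≤ ε / 3 := by
  have hi := integrable_of_continuous (q := q) (continuous_hat hq k)
  have e1 : (moments hq).toFun k f - c / 3 = ∫ x, hat hq k x * (f x - c) ∂measure q := by
    simp only [mul_sub]
    rw [integral_sub (integrable_hat_mul hq k f) (hi.mul_const c), integral_mul_const,
      integral_hat, moments_apply]
    ring
  have e2 : ε / 3 = ∫ x, hat hq k x * ε ∂measure q := by
    rw [integral_mul_const, integral_hat]; ring
  rw [e1, e2, ← Real.norm_eq_abs]
  refine norm_integral_le_of_norm_le (hi.mul_const ε) (ae_of_all _ fun x => ?_)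
  rw [norm_mul, Real.norm_of_nonneg (hat_nonneg hq k x)]
  exact mul_le_mul_of_nonneg_left (h x) (hat_nonneg hq k x)

/-! ### Normal derivatives and existence for the Dirichlet problem. -/

/-- The normal derivative at `q_k` of the solution with boundary values `b` and Laplacian `f`. -/
def flux (hq : IsEquilateral q) (b : Fin 3 → ℝ) (f : C(gasket q, ℝ)) (k : Fin 3) : ℝ :=
  (moments hq).toFun k f + ∑ i, (b k - b i)

theorem flux_child_self (hq : IsEquilateral q) (b : Fin 3 → ℝ) (f : C(gasket q, ℝ)) (k : Fin 3) :
    flux hq (subdivide b ((moments hq).load f) k) ((1 / 5 : ℝ) • restrict k f) k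
      = 3 / 5 * flux hq b f k := by
  simp only [flux, moments_smul]
  rw [moments_self_similar hq k f]
  simp only [subdivide, Moments.load, Fin.sum_univ_three]
  fin_cases k <;> simp <;> ring

/-- The matching condition at a junction. The load, a level-one integral of `f` against the spline
at the junction, is chosen precisely to make the two normal derivatives cancel. -/
theorem flux_child_add (hq : IsEquilateral q) (b : Fin 3 → ℝ) (f : C(gasket q, ℝ)) {i k : Fin 3}
    (hik : i ≠ k) :
    flux hq (subdivide b ((moments hq).load f) i) ((1 / 5 : ℝ) • restrict i f) k
      + flux hq (subdivide b ((moments hq).load f) k) ((1 / 5 : ℝ) • restrict k f) i = 0 := by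
  simp only [flux, moments_smul]
  simp only [subdivide, Moments.load, Fin.sum_univ_three]
  fin_cases i <;> fin_cases k <;> simp at hik ⊢ <;> ring

/-- The solution of `Δ u = f` with boundary values `b`. -/
def dirichlet (hq : IsEquilateral q) (b : Fin 3 → ℝ) (f : C(gasket q, ℝ)) : gasket q → ℝ :=
  (moments hq).solve hq b f

theorem dirichlet_vertex (hq : IsEquilateral q) (b : Fin 3 → ℝ) (f : C(gasket q, ℝ)) (k : Fin 3) :
    dirichlet hq b f (vertex q k) = b k := Moments.solve_vertex hq _ b f k

theorem dirichlet_cellMap (hq : IsEquilateral q) (b : Fin 3 → ℝ) (f : C(gasket q, ℝ)) (i : Fin 3) :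
    (fun y => dirichlet hq b f (cellMap q i y))
      = dirichlet hq (subdivide b ((moments hq).load f) i) ((1 / 5 : ℝ) • restrict i f) :=
  funext fun y => Moments.solve_cellMap hq _ b f i y

/-- A discrete Gauss–Green formula: the difference quotient at a corner misses the normal derivative
exactly by an integral of `f` over the small corner cell. -/
theorem graphLaplacian_dirichlet_vertex (hq : IsEquilateral q) (m : ℕ) (b : Fin 3 → ℝ)
    (f : C(gasket q, ℝ)) (k : Fin 3) :
    (5 / 3 : ℝ) ^ m * graphLaplacian q m (dirichlet hq b f) (vertex q k)
      = (1 / 3) ^ m * (moments hq).toFun k ((restrict k)^[m] f) - flux hq b f k := by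
  induction m generalizing b f with
  | zero =>
    rw [graphLaplacian_zero_vertex hq]
    simp only [dirichlet_vertex, flux, Function.iterate_zero, id, Finset.sum_sub_distrib]
    ring
  | succ m ih =>
    rw [graphLaplacian_vertex_succ hq, dirichlet_cellMap, pow_succ', mul_assoc, ih,
      flux_child_self, restrict_iterate_smul, moments_smul, Function.iterate_succ_apply]
    ring

theorem wordMap_replicate_vertex (m : ℕ) (k : Fin 3) :
    wordMap q (List.replicate m k) (vertex q k) = vertex q k := by
  induction m with
  | zero => rfl
  | succ m ih =>
    rw [List.replicate_succ]
    simp only [wordMap, Function.comp, ih, cellMap_vertex]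

/-- At a junction the fluxes of the two sides cancel, and what remains is an average of `f` over the
two adjacent cells of level `m`; the oscillation of `f` on them bounds the error. Every other point
becomes a junction after restriction to subcells. -/
theorem abs_graphLaplacian_dirichlet_sub_le (hq : IsEquilateral q) (m : ℕ) (b : Fin 3 → ℝ)
    (f : C(gasket q, ℝ)) {ε : ℝ}
    (hf : ∀ w : List (Fin 3), w.length = m → ∀ x y, |f (wordMap q w x) - f (wordMap q w y)| ≤ ε)
    {x : gasket q} (hx : x ∈ verts q m) (hx0 : x ∉ verts q 0) :
    |3 / 2 * 5 ^ m * graphLaplacian q m (dirichlet hq b f) x - f x| ≤ ε := by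
  induction m generalizing b f ε x with
  | zero => exact absurd hx hx0
  | succ m ih =>
    rcases interior_succ_cases hx hx0 with ⟨i, y, hy, hy0, rfl⟩ | ⟨i, k, hik, rfl⟩
    · rw [graphLaplacian_cellMap_interior hq m _ i hy0, dirichlet_cellMap]
      have h := ih (subdivide b ((moments hq).load f) i) ((1 / 5 : ℝ) • restrict i f)
        -- The right-hand side on the subcell carries the factor `1/5`, which makes up for the lost
        -- factor of `5 ^ (m + 1)`.
        (ε := ε / 5) (fun w hw x y => by
          have := hf (i :: w) (by simp [hw]) x y
          simp only [ContinuousMap.smul_apply, restrict_apply, smul_eq_mul, ← mul_sub, abs_mul]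
          rw [abs_of_pos (by norm_num : (0 : ℝ) < 1 / 5)]
          change |f (cellMap q i (wordMap q w x)) - f (cellMap q i (wordMap q w y))| ≤ ε at this
          linarith) hy hy0
      simp only [ContinuousMap.smul_apply, restrict_apply, smul_eq_mul] at h
      rw [abs_le] at *
      rw [pow_succ]
      constructor <;> linarith
    · have hs : ∀ i k, |(moments hq).toFun k ((restrict k)^[m] (restrict i f))
          - f (cellMap q i (vertex q k)) / 3| ≤ ε / 3 := by
        intro i k
        refine abs_moments_sub_le hq k _ fun x => ?_
        rw [restrict_iterate_apply, restrict_apply]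
        have h := hf (i :: List.replicate m k) (by simp) x (vertex q k)
        simp only [wordMap, Function.comp, wordMap_replicate_vertex] at h
        exact h
      have h1 := graphLaplacian_dirichlet_vertex hq m
        (subdivide b ((moments hq).load f) i) ((1 / 5 : ℝ) • restrict i f) k
      have h2 := graphLaplacian_dirichlet_vertex hq m
        (subdivide b ((moments hq).load f) k) ((1 / 5 : ℝ) • restrict k f) i
      have h3 := flux_child_add hq b f hik
      rw [restrict_iterate_smul, moments_smul] at h1 h2
      rw [graphLaplacian_junction hq m _ hik, dirichlet_cellMap, dirichlet_cellMap]
      have e5 : (5 : ℝ) ^ (m + 1) = 5 * 3 ^ m * (5 / 3) ^ m := by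
        rw [div_pow, pow_succ]; field_simp
      have e3 : (3 : ℝ) ^ m * (1 / 3) ^ m = 1 := by rw [← mul_pow]; norm_num
      set A := graphLaplacian q m (dirichlet hq (subdivide b ((moments hq).load f) i)
        ((1 / 5 : ℝ) • restrict i f)) (vertex q k)
      set B := graphLaplacian q m (dirichlet hq (subdivide b ((moments hq).load f) k)
        ((1 / 5 : ℝ) • restrict k f)) (vertex q i)
      have key : 3 / 2 * 5 ^ (m + 1) * (A + B)
          = 3 / 2 * ((moments hq).toFun k ((restrict k)^[m] (restrict i f))
            + (moments hq).toFun i ((restrict i)^[m] (restrict k f))) := by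
        calc 3 / 2 * 5 ^ (m + 1) * (A + B)
            = 15 / 2 * 3 ^ m * ((5 / 3) ^ m * A + (5 / 3) ^ m * B) := by rw [e5]; ring
          _ = 3 / 2 * (3 ^ m * (1 / 3) ^ m)
              * ((moments hq).toFun k ((restrict k)^[m] (restrict i f))
                + (moments hq).toFun i ((restrict i)^[m] (restrict k f))) := by
            rw [h1, h2]; linear_combination (-(15 / 2) * 3 ^ m) * h3
          _ = _ := by rw [e3, mul_one]
      rw [key]
      have g1 := abs_le.mp (hs i k)
      have g2 := abs_le.mp (hs k i)
      rw [cellMap_vertex_comm k i] at g2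
      rw [abs_le]
      constructor <;> linarith

/-- Existence for the Dirichlet problem. -/
theorem hasLaplacian_dirichlet (hq : IsEquilateral q) (b : Fin 3 → ℝ) (f : C(gasket q, ℝ)) :
    HasLaplacian q (dirichlet hq b f) f := by
  refine ⟨Moments.continuous_solve hq _ b f, f.continuous, fun ε hε => ?_⟩
  obtain ⟨N, hN⟩ := exists_osc_le f.continuous (half_pos hε)
  refine ⟨N, fun m hm x hx hx0 => ?_⟩
  have := abs_graphLaplacian_dirichlet_sub_le hq m b f
    (fun w hw x y => (hN w (hw ▸ hm) x y).le) hx hx0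
  linarith

/-! ### Uniqueness for the Dirichlet problem. -/

/-- For harmonic values the corner difference scales by `3/5` from one level to the next. In general
the error on a triangle is the average, with weights `2/5`, `2/5`, `1/5`, of the Laplacians at the
three midpoints. -/
theorem abs_vertex_sub_le (hq : IsEquilateral q) (m : ℕ) (u : gasket q → ℝ) {C : ℝ}
    (h : ∀ x ∈ verts q (m + 1), x ∉ verts q 0 → |graphLaplacian q (m + 1) u x| ≤ C) (k : Fin 3) :
    |3 / 5 * graphLaplacian q m u (vertex q k) - graphLaplacian q (m + 1) u (vertex q k)| ≤ C := by
  induction m generalizing u with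
  | zero =>
    have hj : ∀ i l : Fin 3, i ≠ l →
        |graphLaplacian q 0 (fun x => u (cellMap q i x)) (vertex q l)
          + graphLaplacian q 0 (fun x => u (cellMap q l x)) (vertex q i)| ≤ C := by
      intro i l hil
      rw [← graphLaplacian_junction hq 0 u hil]
      exact h _ (junction_mem_interior hq 0 hil).1 (junction_mem_interior hq 0 hil).2
    have h01 := hj 0 1 (by decide)
    have h12 := hj 1 2 (by decide)
    have h20 := hj 2 0 (by decide)
    rw [graphLaplacian_vertex_succ hq]
    simp only [graphLaplacian_zero_vertex hq, Fin.sum_univ_three, cellMap_vertex,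
      cellMap_vertex_comm 1 0, cellMap_vertex_comm 2 1, cellMap_vertex_comm 0 2] at *
    rw [abs_le] at *
    fin_cases k <;>
      simp only [Fin.zero_eta, Fin.mk_one, Fin.reduceFinMk, cellMap_vertex,
        cellMap_vertex_comm 1 0, cellMap_vertex_comm 2 1, cellMap_vertex_comm 0 2] <;>
      constructor <;> linarith
  | succ m ih =>
    rw [graphLaplacian_vertex_succ hq, graphLaplacian_vertex_succ hq (m + 1)]
    refine ih _ fun x hx hx0 => ?_
    rw [← graphLaplacian_cellMap_interior hq _ _ _ hx0]
    have := cellMap_mem_interior hq k hx hx0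
    exact h _ this.1 this.2

/-- Up to the factor `5`, the graph Laplacian of one level is an average of that of the next. -/
theorem abs_graphLaplacian_le (hq : IsEquilateral q) (m : ℕ) (u : gasket q → ℝ) {C : ℝ}
    (h : ∀ x ∈ verts q (m + 1), x ∉ verts q 0 → |graphLaplacian q (m + 1) u x| ≤ C)
    {x : gasket q} (hx : x ∈ verts q m) (hx0 : x ∉ verts q 0) :
    |graphLaplacian q m u x| ≤ 5 * C := by
  induction m generalizing u x with
  | zero => exact absurd hx hx0
  | succ m ih =>
    have hr : ∀ i, ∀ x ∈ verts q (m + 1), x ∉ verts q 0 →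
        |graphLaplacian q (m + 1) (fun x => u (cellMap q i x)) x| ≤ C := by
      intro i x hx hx0
      rw [← graphLaplacian_cellMap_interior hq _ _ _ hx0]
      have := cellMap_mem_interior hq i hx hx0
      exact h _ this.1 this.2
    rcases interior_succ_cases hx hx0 with ⟨i, y, hy, hy0, rfl⟩ | ⟨i, k, hik, rfl⟩
    · rw [graphLaplacian_cellMap_interior hq _ _ _ hy0]
      exact ih _ (hr i) hy hy0
    · have h1 := abs_le.mp (abs_vertex_sub_le hq m _ (hr i) k)
      have h2 := abs_le.mp (abs_vertex_sub_le hq m _ (hr k) i)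
      have h3 := junction_mem_interior hq (m + 1) hik
      have h4 := abs_le.mp (h _ h3.1 h3.2)
      rw [graphLaplacian_junction hq _ _ hik] at h4 ⊢
      rw [abs_le]
      constructor <;> linarith

/-- The hypothesis is only that `5^m Δ_m u` tends to zero, but passing down `n` levels costs just a
factor `5^n`. The renormalized Laplacian at a fixed point is thus controlled by those of all higher
levels. -/
theorem graphLaplacian_eq_zero (hq : IsEquilateral q) {u : gasket q → ℝ}
    (hu : HasLaplacian q u 0) (m : ℕ) {x : gasket q} (hx : x ∈ verts q m) (hx0 : x ∉ verts q 0) :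
    graphLaplacian q m u x = 0 := by
  have key : ∀ n m : ℕ, ∀ C : ℝ,
      (∀ x ∈ verts q (m + n), x ∉ verts q 0 → |graphLaplacian q (m + n) u x| ≤ C) →
      ∀ x ∈ verts q m, x ∉ verts q 0 → |graphLaplacian q m u x| ≤ 5 ^ n * C := by
    intro n
    induction n with
    | zero => intro m C h; simpa using h
    | succ n ih =>
      intro m C h x hx hx0
      have := ih m (5 * C) (fun x hx hx0 => abs_graphLaplacian_le hq _ u h hx hx0) x hx hx0
      rw [pow_succ, mul_assoc]; exact this
  by_contra hne
  have hpos := abs_pos.mpr hne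
  obtain ⟨N, hN⟩ := hu.2.2 (|graphLaplacian q m u x|) hpos
  have h5 : (0 : ℝ) < 5 ^ (m + N) := by positivity
  -- The tolerance is `|Δ_m u(x)|` itself; the outcome `|Δ_m u(x)| ≤ 2/3 |Δ_m u(x)| / 5^m` is absurd
  -- unless it vanishes.
  have := key N m (2 / 3 * |graphLaplacian q m u x| / 5 ^ (m + N)) (fun y hy hy0 => by
    have h := (hN (m + N) (by omega) y hy hy0).le
    rw [Pi.zero_apply, sub_zero, abs_mul, abs_of_pos (by positivity)] at h
    rw [le_div_iff₀ h5]; linarith) x hx hx0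
  have e : (5 : ℝ) ^ N * (2 / 3 * |graphLaplacian q m u x| / 5 ^ (m + N))
      = 2 / 3 * |graphLaplacian q m u x| / 5 ^ m := by
    rw [pow_add]; field_simp
  rw [e] at this
  have h1 : (1 : ℝ) ≤ 5 ^ m := one_le_pow₀ (by norm_num)
  have h2 : 2 / 3 * |graphLaplacian q m u x| / 5 ^ m ≤ 2 / 3 * |graphLaplacian q m u x| :=
    div_le_self (by positivity) h1
  linarith

/-- Uniqueness for the Dirichlet problem. -/
theorem eq_zero_of_hasLaplacian_zero (hq : IsEquilateral q) {u : gasket q → ℝ}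
    (hu : HasLaplacian q u 0) (h0 : ∀ i, u (vertex q i) = 0) : u = 0 := by
  have key : ∀ w : List (Fin 3), ∀ u : gasket q → ℝ, (∀ i, u (vertex q i) = 0) →
      (∀ m, ∀ x ∈ verts q m, x ∉ verts q 0 → graphLaplacian q m u x = 0) →
      ∀ i, u (wordMap q w (vertex q i)) = 0 := by
    intro w
    induction w with
    | nil => exact fun u h _ => h
    | cons k w ih =>
      intro u h hl i
      refine ih (fun x => u (cellMap q k x)) ?_ (fun m x hx hx0 => ?_) i
      -- With zero boundary values the three midpoint equations form a nonsingular homogeneous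
      -- system, so zero values propagate to the subcells.
      · have hj : ∀ i l : Fin 3, i ≠ l →
            graphLaplacian q 0 (fun x => u (cellMap q i x)) (vertex q l)
              + graphLaplacian q 0 (fun x => u (cellMap q l x)) (vertex q i) = 0 := by
          intro i l hil
          rw [← graphLaplacian_junction hq 0 u hil]
          exact hl 1 _ (junction_mem_interior hq 0 hil).1 (junction_mem_interior hq 0 hil).2
        have h01 := hj 0 1 (by decide)
        have h12 := hj 1 2 (by decide)
        have h20 := hj 2 0 (by decide)
        simp only [graphLaplacian_zero_vertex hq, Fin.sum_univ_three, cellMap_vertex, h,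
          cellMap_vertex_comm 1 0, cellMap_vertex_comm 2 1, cellMap_vertex_comm 0 2] at h01 h12 h20
        intro i
        fin_cases k <;> fin_cases i <;>
          simp only [Fin.zero_eta, Fin.mk_one, Fin.reduceFinMk, cellMap_vertex, h,
            cellMap_vertex_comm 1 0, cellMap_vertex_comm 2 1, cellMap_vertex_comm 0 2] <;>
          linarith
      · rw [← graphLaplacian_cellMap_interior hq _ _ _ hx0]
        have := cellMap_mem_interior hq k hx hx0
        exact hl _ _ this.1 this.2
  exact eq_zero_of_vertices hu.1 fun w i =>
    key w u h0 (fun m x hx hx0 => graphLaplacian_eq_zero hq hu m hx hx0) i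

/-! ### Calculus of the Laplacian and its iterates. -/

theorem HasLaplacian.add {u v f g : gasket q → ℝ} (hu : HasLaplacian q u f)
    (hv : HasLaplacian q v g) : HasLaplacian q (u + v) (f + g) := by
  refine ⟨hu.1.add hv.1, hu.2.1.add hv.2.1, fun ε hε => ?_⟩
  obtain ⟨N, hN⟩ := hu.2.2 (ε / 2) (half_pos hε)
  obtain ⟨M, hM⟩ := hv.2.2 (ε / 2) (half_pos hε)
  refine ⟨max N M, fun m hm x hx hx0 => ?_⟩
  have h1 := abs_lt.mp (hN m (le_of_max_le_left hm) x hx hx0)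
  have h2 := abs_lt.mp (hM m (le_of_max_le_right hm) x hx hx0)
  rw [graphLaplacian_add, Pi.add_apply, abs_lt]
  constructor <;> linarith

theorem HasLaplacian.smul {u f : gasket q → ℝ} (c : ℝ) (hu : HasLaplacian q u f) :
    HasLaplacian q (c • u) (c • f) := by
  refine ⟨hu.1.const_smul c, hu.2.1.const_smul c, fun ε hε => ?_⟩
  have hc : 0 < |c| + 1 := by positivity
  obtain ⟨N, hN⟩ := hu.2.2 (ε / (|c| + 1)) (by positivity)
  refine ⟨N, fun m hm x hx hx0 => ?_⟩
  have h := hN m hm x hx hx0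
  rw [lt_div_iff₀ hc] at h
  rw [graphLaplacian_smul, Pi.smul_apply, smul_eq_mul,
    show 3 / 2 * 5 ^ m * (c * graphLaplacian q m u x) - c * f x
      = c * (3 / 2 * 5 ^ m * graphLaplacian q m u x - f x) by ring, abs_mul]
  nlinarith [abs_nonneg (3 / 2 * 5 ^ m * graphLaplacian q m u x - f x)]

theorem HasLaplacian.sub {u v f g : gasket q → ℝ} (hu : HasLaplacian q u f)
    (hv : HasLaplacian q v g) : HasLaplacian q (u - v) (f - g) := by
  have := hu.add (hv.smul (-1))
  simpa [sub_eq_add_neg] using this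

theorem HasLaplacian.comp_cellMap (hq : IsEquilateral q) {u f : gasket q → ℝ}
    (hu : HasLaplacian q u f) (i : Fin 3) :
    HasLaplacian q (fun x => u (cellMap q i x)) ((1 / 5 : ℝ) • fun x => f (cellMap q i x)) := by
  refine ⟨hu.1.comp (continuous_cellMap i), (hu.2.1.comp (continuous_cellMap i)).const_smul _,
    fun ε hε => ?_⟩
  obtain ⟨N, hN⟩ := hu.2.2 (5 * ε) (by positivity)
  refine ⟨N, fun m hm x hx hx0 => ?_⟩
  have hi := cellMap_mem_interior hq i hx hx0
  have h := abs_lt.mp (hN (m + 1) (by omega) _ hi.1 hi.2)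
  rw [graphLaplacian_cellMap_interior hq _ _ _ hx0, pow_succ] at h
  simp only [Pi.smul_apply, smul_eq_mul]
  rw [abs_lt]
  constructor <;> linarith

theorem HasLaplacian.comp_cellMap_zero (hq : IsEquilateral q) {u : gasket q → ℝ}
    (hu : HasLaplacian q u 0) (i : Fin 3) : HasLaplacian q (fun x => u (cellMap q i x)) 0 := by
  have h := hu.comp_cellMap hq i
  rwa [show ((1 / 5 : ℝ) • fun x => (0 : gasket q → ℝ) (cellMap q i x)) = 0 from
    smul_zero (1 / 5 : ℝ)] at h

theorem HasLaplacian.comp_symmMap (hq : IsEquilateral q) {u f : gasket q → ℝ}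
    (hu : HasLaplacian q u f) (s : Equiv.Perm (Fin 3)) :
    HasLaplacian q (fun x => u (symmMap q s x)) (fun x => f (symmMap q s x)) := by
  refine ⟨hu.1.comp (continuous_symmMap hq s), hu.2.1.comp (continuous_symmMap hq s),
    fun ε hε => ?_⟩
  obtain ⟨N, hN⟩ := hu.2.2 ε hε
  refine ⟨N, fun m hm x hx hx0 => ?_⟩
  rw [graphLaplacian_symmMap hq]
  refine hN m hm _ (symmMap_mem_verts hq s hx) fun h => hx0 ?_
  rw [← symmMap_inv_symmMap hq s x]
  exact symmMap_mem_verts hq _ h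

theorem verts_subset_succ (m : ℕ) : verts q m ⊆ verts q (m + 1) := by
  induction m with
  | zero =>
    intro x hx
    obtain ⟨i, rfl⟩ := mem_verts_zero.mp hx
    exact vertex_mem_verts _ i
  | succ m ih =>
    intro x hx
    obtain ⟨i, y, hy, rfl⟩ := mem_verts_succ.mp hx
    exact mem_verts_succ.mpr ⟨i, y, ih hy, rfl⟩

theorem verts_mono : Monotone (verts q) := monotone_nat_of_le_succ verts_subset_succ

theorem wordMap_junction_mem_interior (hq : IsEquilateral q) (w : List (Fin 3)) :
    wordMap q w (cellMap q 0 (vertex q 1)) ∈ verts q (w.length + 1) ∧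
      wordMap q w (cellMap q 0 (vertex q 1)) ∉ verts q 0 := by
  induction w with
  | nil => exact junction_mem_interior hq 0 (by decide)
  | cons i w ih => exact cellMap_mem_interior hq i ih.1 ih.2

theorem HasLaplacian.unique (hq : IsEquilateral q) {u f g : gasket q → ℝ}
    (hf : HasLaplacian q u f) (hg : HasLaplacian q u g) : f = g := by
  have key : ∀ m, ∀ x ∈ verts q m, x ∉ verts q 0 → f x = g x := by
    intro m x hx hx0
    refine eq_of_forall_dist_le fun ε hε => ?_
    obtain ⟨N, hN⟩ := hf.2.2 (ε / 2) (half_pos hε)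
    obtain ⟨M, hM⟩ := hg.2.2 (ε / 2) (half_pos hε)
    have hmem := verts_mono (le_max_left m (max N M)) hx
    have h1 := abs_lt.mp (hN (max m (max N M)) (by simp) x hmem hx0)
    have h2 := abs_lt.mp (hM (max m (max N M)) (by simp) x hmem hx0)
    rw [Real.dist_eq, abs_le]
    constructor <;> linarith
  funext x
  refine eq_of_forall_dist_le fun ε hε => ?_
  obtain ⟨N, hN⟩ := exists_osc_le (hf.2.1.sub hg.2.1) hε
  obtain ⟨w, y, hw, rfl⟩ := exists_wordMap N x
  -- Every cell contains the image of a midpoint, which is never in `V_0`; there the two candidates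
  -- agree.
  have h := hN w hw.ge y (cellMap q 0 (vertex q 1))
  have hi := wordMap_junction_mem_interior hq w
  simp only [Pi.sub_apply, key _ _ hi.1 hi.2, sub_self, sub_zero] at h
  exact h.le

theorem HasIterLaplacian.unique (hq : IsEquilateral q) {m : ℕ} {u f g : gasket q → ℝ}
    (hf : HasIterLaplacian q m u f) (hg : HasIterLaplacian q m u g) : f = g := by
  induction m generalizing f g with
  | zero => exact (show f = u from hf).trans (show g = u from hg).symm
  | succ m ih =>
    obtain ⟨f', hf', hf⟩ := hf
    obtain ⟨g', hg', hg⟩ := hg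
    rw [ih hf' hg'] at hf
    exact hf.unique hq hg

theorem HasIterLaplacian.add {m : ℕ} {u v f g : gasket q → ℝ} (hu : HasIterLaplacian q m u f)
    (hv : HasIterLaplacian q m v g) : HasIterLaplacian q m (u + v) (f + g) := by
  induction m generalizing f g with
  | zero => rw [show f = u from hu, show g = v from hv]; rfl
  | succ m ih =>
    obtain ⟨f', hf', hf⟩ := hu
    obtain ⟨g', hg', hg⟩ := hv
    exact ⟨_, ih hf' hg', hf.add hg⟩

theorem HasIterLaplacian.smul {m : ℕ} {u f : gasket q → ℝ} (c : ℝ)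
    (hu : HasIterLaplacian q m u f) : HasIterLaplacian q m (c • u) (c • f) := by
  induction m generalizing f with
  | zero => rw [show f = u from hu]; rfl
  | succ m ih =>
    obtain ⟨f', hf', hf⟩ := hu
    exact ⟨_, ih hf', hf.smul c⟩

theorem HasIterLaplacian.comp_symmMap (hq : IsEquilateral q) {m : ℕ} {u f : gasket q → ℝ}
    (hu : HasIterLaplacian q m u f) (s : Equiv.Perm (Fin 3)) :
    HasIterLaplacian q m (fun x => u (symmMap q s x)) (fun x => f (symmMap q s x)) := by
  induction m generalizing f with
  | zero => rw [show f = u from hu]; rfl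
  | succ m ih =>
    obtain ⟨f', hf', hf⟩ := hu
    exact ⟨_, ih hf', hf.comp_symmMap hq s⟩

theorem HasIterLaplacian.continuous {m : ℕ} {u f : gasket q → ℝ}
    (hu : HasIterLaplacian q (m + 1) u f) : Continuous u := by
  induction m generalizing f with
  | zero =>
    obtain ⟨g, hg, hf⟩ := hu
    rw [← show g = u from hg]
    exact hf.1
  | succ m ih =>
    obtain ⟨g, hg, -⟩ := hu
    exact ih hg

/-! ### Odd polynomials. -/

/-- The reflection at `q_n` is `k ↦ 2n - k`: it fixes `n` and exchanges `n + 1` with `n - 1`. -/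
theorem reflection_apply_self (n : Fin 3) : Equiv.subLeft (n + n) n = n := by
  simp

theorem eq_zero_of_neg_symmMap (hq : IsEquilateral q) {u : gasket q → ℝ} {n : Fin 3}
    (hu : ∀ x, u (symmMap q (Equiv.subLeft (n + n)) x) = -u x) : u (vertex q n) = 0 := by
  have := hu (vertex q n)
  rw [symmMap_vertex hq, reflection_apply_self] at this
  linarith

/-- A polynomial that is odd under all three reflections vanishes. -/
theorem HasIterLaplacian.eq_zero_of_odd (hq : IsEquilateral q) {m : ℕ} {u : gasket q → ℝ}
    (hu : HasIterLaplacian q m u 0)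
    (hodd : ∀ n x, u (symmMap q (Equiv.subLeft (n + n)) x) = -u x) : u = 0 := by
  induction m with
  | zero => exact (show 0 = u from hu).symm
  | succ m ih =>
    obtain ⟨g, hg, hg0⟩ := hu
    have hgodd : ∀ (n : Fin 3) x, g (symmMap q (Equiv.subLeft (n + n)) x) = -g x := by
      intro n x
      have h1 := hg.comp_symmMap hq (Equiv.subLeft (n + n))
      rw [show (fun x => u (symmMap q (Equiv.subLeft (n + n)) x)) = (-1 : ℝ) • u by
        funext x; simp [hodd n x]] at h1
      have := congrFun (h1.unique hq (hg.smul (-1))) x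
      simpa using this
    -- The last Laplacian before zero is harmonic and odd, hence zero at each vertex, hence zero;
    -- the degree drops.
    rw [eq_zero_of_hasLaplacian_zero hq hg0 fun n => eq_zero_of_neg_symmMap hq (hgodd n)] at hg
    exact ih hg

/-! ### Jets at a vertex and uniqueness of monomials. -/

theorem dirichlet_zero_cellMap (hq : IsEquilateral q) (b : Fin 3 → ℝ) (i : Fin 3) (y : gasket q) :
    dirichlet hq b 0 (cellMap q i y) = dirichlet hq (subdivide b 0 i) 0 y := by
  have h := congrFun (dirichlet_cellMap hq b 0 i) y
  have hr : restrict i (0 : C(gasket q, ℝ)) = 0 := rfl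
  have hl : (moments hq).load 0 = 0 := by
    funext i k
    have hr : ∀ i, restrict i (0 : C(gasket q, ℝ)) = 0 := fun _ => rfl
    simp [Moments.load, moments_apply, hr]
  rw [hr, hl, smul_zero] at h
  exact h

theorem dirichlet_zero_iterate (hq : IsEquilateral q) (b : Fin 3 → ℝ) (n k : Fin 3) (m : ℕ) :
    dirichlet hq b 0 ((cellMap q n)^[m] (vertex q k))
      = (fun b => subdivide b 0 n)^[m] b k := by
  induction m generalizing b with
  | zero => exact dirichlet_vertex hq b 0 k
  | succ m ih =>
    rw [Function.iterate_succ_apply', dirichlet_zero_cellMap, ih, Function.iterate_succ_apply]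

/-- Restriction to the corner cell acts on harmonic boundary values with eigenvalues `1`, `3/5`,
`1/5`. The quotients that define both derivatives are therefore constant in `m`. -/
theorem iterate_subdivide (b : Fin 3 → ℝ) (n : Fin 3) (m : ℕ) :
    (fun b => subdivide b 0 n)^[m] b n = b n ∧
    (5 / 3 : ℝ) ^ m * (2 * b n - (fun b => subdivide b 0 n)^[m] b (n + 1)
      - (fun b => subdivide b 0 n)^[m] b (n - 1)) = 2 * b n - b (n + 1) - b (n - 1) ∧
    (5 : ℝ) ^ m * ((fun b => subdivide b 0 n)^[m] b (n + 1)
      - (fun b => subdivide b 0 n)^[m] b (n - 1)) = b (n + 1) - b (n - 1) := by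
  induction m generalizing b with
  | zero => simp
  | succ m ih =>
    obtain ⟨h1, h2, h3⟩ := ih (subdivide b 0 n)
    simp only [Function.iterate_succ_apply]
    have e : subdivide b 0 n n = b n := by simp [subdivide]
    have e2 : 2 * b n - subdivide b 0 n (n + 1) - subdivide b 0 n (n - 1)
        = 3 / 5 * (2 * b n - b (n + 1) - b (n - 1)) := by
      unfold subdivide
      fin_cases n <;> simp [show (-1 : Fin 3) = 2 from rfl] <;> ring
    have e3 : subdivide b 0 n (n + 1) - subdivide b 0 n (n - 1)
        = 1 / 5 * (b (n + 1) - b (n - 1)) := by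
      unfold subdivide
      fin_cases n <;> simp [show (-1 : Fin 3) = 2 from rfl] <;> ring
    rw [e] at h1 h2
    rw [e2] at h2
    rw [e3] at h3
    refine ⟨h1, ?_, ?_⟩
    · rw [pow_succ', mul_assoc, h2]; ring
    · rw [pow_succ', mul_assoc, h3]; ring

theorem eq_dirichlet_zero (hq : IsEquilateral q) {u : gasket q → ℝ} (hu : HasLaplacian q u 0) :
    u = dirichlet hq (fun k => u (vertex q k)) 0 := by
  have h := hu.sub (hasLaplacian_dirichlet hq (fun k => u (vertex q k)) 0)
  rw [show (0 : gasket q → ℝ) - ((0 : C(gasket q, ℝ)) : gasket q → ℝ) = 0 by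
    funext x; simp] at h
  exact sub_eq_zero.mp (eq_zero_of_hasLaplacian_zero hq h fun i => by simp [dirichlet_vertex])

/-- A harmonic function is determined by its value and derivatives at one vertex. -/
theorem eq_zero_of_derivs (hq : IsEquilateral q) {u : gasket q → ℝ} (hu : HasLaplacian q u 0)
    {n : Fin 3} (h0 : u (vertex q n) = 0) (hn : HasNormalDeriv q u n 0)
    (ht : HasTangentialDeriv q u n 0) : u = 0 := by
  set b : Fin 3 → ℝ := fun k => u (vertex q k) with hb
  have e := eq_dirichlet_zero hq hu
  have e1 : 2 * b n - b (n + 1) - b (n - 1) = 0 := by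
    refine tendsto_nhds_unique (tendsto_const_nhds.congr fun m => ?_) hn
    rw [← (iterate_subdivide b n m).2.1, e, dirichlet_zero_iterate, dirichlet_zero_iterate,
      dirichlet_vertex]
  have e2 : b (n + 1) - b (n - 1) = 0 := by
    refine tendsto_nhds_unique (tendsto_const_nhds.congr fun m => ?_) ht
    rw [← (iterate_subdivide b n m).2.2, e, dirichlet_zero_iterate, dirichlet_zero_iterate]
  have e0 : b n = 0 := h0
  refine eq_zero_of_hasLaplacian_zero hq hu fun i => ?_
  have : i = n ∨ i = n + 1 ∨ i = n - 1 := by clear * -; revert i n; decide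
  change b i = 0
  rcases this with rfl | rfl | rfl <;> linarith

/-- Descent on the degree: the Laplacian of order one less is harmonic with zero jet, so it vanishes
by `eq_zero_of_derivs`. -/
theorem HasIterLaplacian.eq_zero_of_jet (hq : IsEquilateral q) {j : ℕ} {u : gasket q → ℝ}
    {n : Fin 3} (hu : HasIterLaplacian q j u 0)
    (h : ∀ m < j, ∃ f, HasIterLaplacian q m u f ∧ f (vertex q n) = 0 ∧ HasNormalDeriv q f n 0 ∧
      HasTangentialDeriv q f n 0) : u = 0 := by
  induction j with
  | zero => exact (show 0 = u from hu).symm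
  | succ j ih =>
    obtain ⟨g, hg, hg0⟩ := hu
    obtain ⟨f, hf, h0, hn, ht⟩ := h j (Nat.lt_succ_self j)
    rw [hf.unique hq hg] at h0 hn ht
    rw [eq_zero_of_derivs hq hg0 h0 hn ht] at hg
    exact ih hg fun m hm => h m (by omega)

theorem HasNormalDeriv.sub {u v : gasket q → ℝ} {i : Fin 3} {a b : ℝ}
    (hu : HasNormalDeriv q u i a) (hv : HasNormalDeriv q v i b) :
    HasNormalDeriv q (u - v) i (a - b) := by
  refine (Tendsto.sub hu hv).congr fun m => ?_
  simp only [Pi.sub_apply]; ring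

theorem HasTangentialDeriv.sub {u v : gasket q → ℝ} {i : Fin 3} {a b : ℝ}
    (hu : HasTangentialDeriv q u i a) (hv : HasTangentialDeriv q v i b) :
    HasTangentialDeriv q (u - v) i (a - b) := by
  refine (Tendsto.sub hu hv).congr fun m => ?_
  simp only [Pi.sub_apply]; ring

theorem IsMonomial.unique (hq : IsEquilateral q) {j i : ℕ} {n : Fin 3} {u v : gasket q → ℝ}
    (hu : IsMonomial q j i n u) (hv : IsMonomial q j i n v) : u = v := by
  rw [← sub_eq_zero]
  have hsub : ∀ m f g, HasIterLaplacian q m u f → HasIterLaplacian q m v g →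
      HasIterLaplacian q m (u - v) (f - g) := by
    intro m f g hf hg
    have := hf.add (hg.smul (-1))
    simpa [sub_eq_add_neg] using this
  refine HasIterLaplacian.eq_zero_of_jet (j := j + 1) (n := n) hq
    (by simpa using hsub _ _ _ hu.1 hv.1) fun m hm => ?_
  obtain ⟨f, hf, f0, fn, ft⟩ := hu.2 m (by omega)
  obtain ⟨g, hg, g0, gn, gt⟩ := hv.2 m (by omega)
  refine ⟨_, hsub _ _ _ hf hg, by simp [f0, g0], ?_, ?_⟩
  · simpa using fn.sub gn
  · simpa using ft.sub gt

/-! ### Existence of the antisymmetric monomials. -/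

/-- A continuous function that is odd under the reflection at `q_n` and is multiplied by
`5^{-(k+1)}` under composition with `F_n`. -/
structure IsOddScaling (q : Fin 3 → EuclideanSpace ℝ (Fin 2)) (n : Fin 3) (k : ℕ)
    (f : gasket q → ℝ) : Prop where
  continuous : Continuous f
  odd : ∀ x, f (symmMap q (Equiv.subLeft (n + n)) x) = -f x
  scaling : ∀ x, f (cellMap q n x) = (1 / 5) ^ (k + 1) * f x

theorem IsOddScaling.iterate {n : Fin 3} {k : ℕ} {f : gasket q → ℝ} (h : IsOddScaling q n k f)
    (m : ℕ) (x : gasket q) : f ((cellMap q n)^[m] x) = ((1 / 5) ^ (k + 1)) ^ m * f x := by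
  induction m with
  | zero => simp
  | succ m ih => rw [Function.iterate_succ_apply', h.scaling, ih]; ring

theorem neg_vertex_of_odd (hq : IsEquilateral q) {n : Fin 3} {f : gasket q → ℝ}
    (h : ∀ x, f (symmMap q (Equiv.subLeft (n + n)) x) = -f x) :
    f (vertex q (n - 1)) = -f (vertex q (n + 1)) := by
  have := h (vertex q (n + 1))
  rwa [symmMap_vertex hq, show Equiv.subLeft (n + n) (n + 1) = n - 1 by
    simp only [Equiv.subLeft_apply]; abel] at this

theorem IsOddScaling.hasNormalDeriv (hq : IsEquilateral q) {n : Fin 3} {k : ℕ}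
    {f : gasket q → ℝ} (h : IsOddScaling q n k f) : HasNormalDeriv q f n 0 := by
  refine tendsto_const_nhds.congr fun m => ?_
  rw [h.iterate, h.iterate, eq_zero_of_neg_symmMap hq h.odd, neg_vertex_of_odd hq h.odd]
  ring

/-- The quotient is `5^m 5^{-(k+1)m}` times a constant: stationary for `k = 0`, geometrically
decaying otherwise. -/
theorem IsOddScaling.hasTangentialDeriv (hq : IsEquilateral q) {n : Fin 3} {k : ℕ}
    {f : gasket q → ℝ} (h : IsOddScaling q n k f) :
    HasTangentialDeriv q f n (if k = 0 then 2 * f (vertex q (n + 1)) else 0) := by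
  have e : ∀ m : ℕ, ((1 / 5 : ℝ) ^ k) ^ m * (2 * f (vertex q (n + 1))) =
      5 ^ m * (f ((cellMap q n)^[m] (vertex q (n + 1)))
        - f ((cellMap q n)^[m] (vertex q (n - 1)))) := by
    intro m
    rw [h.iterate, h.iterate, neg_vertex_of_odd hq h.odd, pow_succ, mul_pow]
    have : (5 : ℝ) ^ m * (1 / 5) ^ m = 1 := by rw [← mul_pow]; norm_num
    linear_combination (-(((1 / 5 : ℝ) ^ k) ^ m * (2 * f (vertex q (n + 1))))) * this
  unfold HasTangentialDeriv
  refine Tendsto.congr e ?_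
  split_ifs with hk
  · simp [hk]
  · have h1 : (1 / 5 : ℝ) ^ k < 1 := pow_lt_one₀ (by norm_num) (by norm_num) hk
    simpa using (tendsto_pow_atTop_nhds_zero_of_lt_one (by positivity) h1).mul_const
      (2 * f (vertex q (n + 1)))

/-- Oddness leaves a single free boundary value, so odd harmonic functions form a line. -/
theorem eq_of_harmonic_odd (hq : IsEquilateral q) {n : Fin 3} {u v : gasket q → ℝ}
    (hu : HasLaplacian q u 0) (hv : HasLaplacian q v 0)
    (huo : ∀ x, u (symmMap q (Equiv.subLeft (n + n)) x) = -u x)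
    (hvo : ∀ x, v (symmMap q (Equiv.subLeft (n + n)) x) = -v x)
    (h : u (vertex q (n + 1)) = v (vertex q (n + 1))) : u = v := by
  rw [← sub_eq_zero]
  refine eq_zero_of_hasLaplacian_zero hq (by simpa using hu.sub hv) fun i => ?_
  have : i = n ∨ i = n + 1 ∨ i = n - 1 := by clear * -; revert i n; decide
  rw [Pi.sub_apply, sub_eq_zero]
  rcases this with rfl | rfl | rfl
  · rw [eq_zero_of_neg_symmMap hq huo, eq_zero_of_neg_symmMap hq hvo]
  · exact h
  · rw [neg_vertex_of_odd hq huo, neg_vertex_of_odd hq hvo, h]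

theorem odd_comp_cellMap (hq : IsEquilateral q) {n : Fin 3} {u : gasket q → ℝ}
    (h : ∀ x, u (symmMap q (Equiv.subLeft (n + n)) x) = -u x) (x : gasket q) :
    u (cellMap q n (symmMap q (Equiv.subLeft (n + n)) x)) = -u (cellMap q n x) := by
  rw [← h, symmMap_cellMap hq, reflection_apply_self]

/-- The Dirichlet problem preserves oddness. -/
theorem dirichlet_odd (hq : IsEquilateral q) {n : Fin 3} {b : Fin 3 → ℝ} {f : C(gasket q, ℝ)}
    (hf : ∀ x, f (symmMap q (Equiv.subLeft (n + n)) x) = -f x)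
    (hb : ∀ i, b (n + n - i) = -b i) (x : gasket q) :
    dirichlet hq b f (symmMap q (Equiv.subLeft (n + n)) x) = -dirichlet hq b f x := by
  have h1 := hasLaplacian_dirichlet hq b f
  have h2 := (h1.comp_symmMap hq (Equiv.subLeft (n + n))).add h1
  rw [show (fun x => f (symmMap q (Equiv.subLeft (n + n)) x)) + (f : gasket q → ℝ) = 0 by
    funext x; simp [hf]] at h2
  have h3 := congrFun (eq_zero_of_hasLaplacian_zero hq h2 fun i => by
    rw [Pi.add_apply, symmMap_vertex hq, dirichlet_vertex, dirichlet_vertex, Equiv.subLeft_apply,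
      hb, neg_add_cancel]) x
  simp only [Pi.add_apply, Pi.zero_apply] at h3
  linarith

theorem exists_harmonic_odd (hq : IsEquilateral q) (n : Fin 3) :
    ∃ a, IsOddScaling q n 0 a ∧ HasLaplacian q a 0 ∧ a (vertex q (n + 1)) = 1 / 2 := by
  -- The values `±1/2` make the tangential derivative equal to `1`.
  set b : Fin 3 → ℝ := fun k => if k = n + 1 then 1 / 2 else if k = n - 1 then -(1 / 2) else 0
    with hb
  have hbo : ∀ i, b (n + n - i) = -b i := by
    intro i
    have h1 : n + n - i = n + 1 ↔ i = n - 1 := by clear * -; revert i n; decide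
    have h2 : n + n - i = n - 1 ↔ i = n + 1 := by clear * -; revert i n; decide
    have h3 : n + 1 ≠ n - 1 := by clear * -; revert n; decide
    simp only [hb, h1, h2]
    split_ifs with h4 h5
    · exact absurd (h5.symm.trans h4) h3
    · rw [neg_neg]
    · rfl
    · rw [neg_zero]
  have hl : HasLaplacian q (dirichlet hq b 0) 0 := hasLaplacian_dirichlet hq b 0
  have ho := dirichlet_odd hq (n := n) (b := b) (f := 0) (by simp) hbo
  have hv : dirichlet hq b 0 (vertex q (n + 1)) = 1 / 2 := by
    rw [dirichlet_vertex, hb]; simp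
  refine ⟨dirichlet hq b 0, ⟨hl.1, ho, fun x => ?_⟩, hl, hv⟩
  have h := eq_of_harmonic_odd hq (n := n) (u := fun x => dirichlet hq b 0 (cellMap q n x))
    (v := (1 / 5 : ℝ) • dirichlet hq b 0) (hl.comp_cellMap_zero hq n)
    (by simpa using hl.smul (1 / 5)) (odd_comp_cellMap hq ho) (fun x => by simp [ho]) (by
      rw [Pi.smul_apply, hv, dirichlet_zero_cellMap, dirichlet_vertex, hb]
      unfold subdivide
      fin_cases n <;> simp [Fin.ext_iff, Fin.sub_def, Fin.add_def] <;> norm_num)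
  simpa using congrFun h x

/-- Any odd solution `u` fails to scale by `r` only up to an odd harmonic function, that is, a
multiple `c • a`. Since `a` scales by `1/5` and `r ≠ 1/5`, adding `c / (r - 1/5)` times `a` removes
the defect. -/
theorem IsOddScaling.exists_hasLaplacian (hq : IsEquilateral q) {n : Fin 3} {k : ℕ}
    {f : gasket q → ℝ} (hf : IsOddScaling q n k f) :
    ∃ v, IsOddScaling q n (k + 1) v ∧ HasLaplacian q v f := by
  obtain ⟨a, ha, hal, hav⟩ := exists_harmonic_odd hq n
  set u := dirichlet hq 0 ⟨f, hf.continuous⟩ with hu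
  have hul : HasLaplacian q u f := hasLaplacian_dirichlet hq 0 ⟨f, hf.continuous⟩
  have huo := dirichlet_odd hq (n := n) (b := 0) (f := ⟨f, hf.continuous⟩) hf.odd (by simp)
  rw [← hu] at huo
  set r : ℝ := (1 / 5) ^ (k + 1 + 1) with hr
  have hlt : r < 1 / 5 := by
    rw [hr, pow_succ]
    have : (1 / 5 : ℝ) ^ (k + 1) < 1 := pow_lt_one₀ (by norm_num) (by norm_num) (by omega)
    linarith
  -- Chosen to match the defect at `q_{n+1}`, where `a` is `1/2`.
  set c : ℝ := 2 * (u (cellMap q n (vertex q (n + 1))) - r * u (vertex q (n + 1))) with hc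
  have hdef : (fun x => u (cellMap q n x)) - r • u = c • a := by
    have h1 := (hul.comp_cellMap hq n).sub (hul.smul r)
    rw [show (1 / 5 : ℝ) • (fun x => f (cellMap q n x)) - r • f = 0 by
      funext x
      simp only [Pi.sub_apply, Pi.smul_apply, smul_eq_mul, hf.scaling, hr, Pi.zero_apply]
      ring] at h1
    refine eq_of_harmonic_odd hq (n := n) h1 (by simpa using hal.smul c) (fun x => ?_) (fun x => ?_) ?_
    · simp only [Pi.sub_apply, Pi.smul_apply, smul_eq_mul, odd_comp_cellMap hq huo, huo]; ring
    · simp only [Pi.smul_apply, smul_eq_mul, ha.odd]; ring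
    · simp only [Pi.sub_apply, Pi.smul_apply, smul_eq_mul, hav, hc]; ring
  refine ⟨u + (c / (r - 1 / 5)) • a, ⟨hul.1.add (ha.continuous.const_smul _), fun x => ?_,
    fun x => ?_⟩, by simpa using hul.add (hal.smul _)⟩
  · simp only [Pi.add_apply, Pi.smul_apply, smul_eq_mul, ha.odd, huo]; ring
  · have h2 := congrFun hdef x
    simp only [Pi.sub_apply, Pi.smul_apply, smul_eq_mul] at h2
    have h3 := ha.scaling x
    simp only [Pi.add_apply, Pi.smul_apply, smul_eq_mul]
    rw [h3, ← hr]
    have h4 : c / (r - 1 / 5) * (r - 1 / 5) = c := div_mul_cancel₀ _ (by linarith)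
    linear_combination h2 - a x * h4

theorem exists_isMonomial (hq : IsEquilateral q) (j : ℕ) (n : Fin 3) :
    ∃ u, IsMonomial q j 3 n u := by
  obtain ⟨a, ha, hal, hav⟩ := exists_harmonic_odd hq n
  have hstep : ∀ k (f : gasket q → ℝ), ∃ v, IsOddScaling q n k f →
      IsOddScaling q n (k + 1) v ∧ HasLaplacian q v f := by
    intro k f
    by_cases hf : IsOddScaling q n k f
    · obtain ⟨v, hv⟩ := hf.exists_hasLaplacian hq
      exact ⟨v, fun _ => hv⟩
    -- The default `0` makes the choice total, so that the tower `p` can be defined by plain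
    -- recursion.
    · exact ⟨0, fun h => absurd h hf⟩
  choose next hnext using hstep
  set p : ℕ → gasket q → ℝ := fun k => Nat.rec a next k with hp
  have hodd : ∀ k, IsOddScaling q n k (p k) := by
    intro k
    induction k with
    | zero => exact ha
    | succ k ih => exact (hnext k _ ih).1
  have hlap : ∀ k, HasLaplacian q (p (k + 1)) (p k) := fun k => (hnext k _ (hodd k)).2
  have hiter : ∀ m ≤ j, HasIterLaplacian q m (p j) (p (j - m)) := by
    intro m
    induction m with
    | zero => intro _; rfl
    | succ m ih =>
      intro hm
      refine ⟨_, ih (by omega), ?_⟩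
      have := hlap (j - (m + 1))
      rwa [show j - (m + 1) + 1 = j - m by omega] at this
  refine ⟨p j, ⟨p 0, by simpa using hiter j le_rfl, hal⟩, fun m hm => ⟨_, hiter m hm, ?_, ?_, ?_⟩⟩
  · simpa using eq_zero_of_neg_symmMap hq (hodd _).odd
  · simpa using (hodd (j - m)).hasNormalDeriv hq
  · have h := (hodd (j - m)).hasTangentialDeriv hq
    by_cases hmj : m = j
    · subst hmj
      simp only [Nat.sub_self] at h ⊢
      rw [show p 0 (vertex q (n + 1)) = 1 / 2 from hav] at h
      simpa using h
    · rw [if_neg (show j - m ≠ 0 by omega)] at h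
      simpa [hmj] using h

/-! ### Action of the symmetries on monomials. -/

theorem symmMap_iterate (hq : IsEquilateral q) (s : Equiv.Perm (Fin 3)) (n : Fin 3) (m : ℕ)
    (x : gasket q) :
    symmMap q s ((cellMap q n)^[m] x) = (cellMap q (s n))^[m] (symmMap q s x) := by
  induction m with
  | zero => rfl
  | succ m ih => rw [Function.iterate_succ_apply', symmMap_cellMap hq, ih,
      Function.iterate_succ_apply']

theorem IsMonomial.comp_rotation (hq : IsEquilateral q) {j : ℕ} {n : Fin 3} {u : gasket q → ℝ}
    (hu : IsMonomial q j 3 (n + 1) u) :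
    IsMonomial q j 3 n fun x => u (symmMap q (Equiv.addRight 1) x) := by
  have e2 : n - 1 + 1 = n + 1 - 1 := by abel
  refine ⟨hu.1.comp_symmMap hq _, fun m hm => ?_⟩
  obtain ⟨f, hf, h0, hn, ht⟩ := hu.2 m hm
  refine ⟨_, hf.comp_symmMap hq _, ?_, ?_, ?_⟩
  · rwa [symmMap_vertex hq]
  · refine hn.congr fun k => ?_
    simp only [symmMap_iterate hq, symmMap_vertex hq, Equiv.coe_addRight, e2]
  · refine ht.congr fun k => ?_
    simp only [symmMap_iterate hq, symmMap_vertex hq, Equiv.coe_addRight, e2]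

/-- A reflection exchanges the two neighbours in the difference that defines the tangential
derivative; the factor `-1` restores the normalization. -/
theorem IsMonomial.neg_comp_reflection (hq : IsEquilateral q) {j : ℕ} {a n : Fin 3}
    {u : gasket q → ℝ} (hu : IsMonomial q j 3 (a - n) u) :
    IsMonomial q j 3 n ((-1 : ℝ) • fun x => u (symmMap q (Equiv.subLeft a) x)) := by
  have e1 : a - (n + 1) = a - n - 1 := by abel
  have e2 : a - (n - 1) = a - n + 1 := by abel
  refine ⟨?_, fun m hm => ?_⟩
  · have h := (HasIterLaplacian.comp_symmMap hq hu.1 (Equiv.subLeft a)).smul (-1)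
    rwa [show ((-1 : ℝ) • fun x => (0 : gasket q → ℝ) (symmMap q (Equiv.subLeft a) x)) = 0 from
      smul_zero (-1 : ℝ)] at h
  obtain ⟨f, hf, h0, hn, ht⟩ := hu.2 m hm
  refine ⟨_, (hf.comp_symmMap hq _).smul (-1), ?_, ?_, ?_⟩
  · simp only [Pi.smul_apply, symmMap_vertex hq, Equiv.subLeft_apply, h0]
    simp
  · have hn' := hn.neg
    rw [show -(if m = j ∧ 3 = 2 then (1 : ℝ) else 0) = if m = j ∧ 3 = 2 then 1 else 0 by simp]
      at hn'
    refine hn'.congr fun k => ?_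
    simp only [Pi.smul_apply, symmMap_iterate hq, symmMap_vertex hq, Equiv.subLeft_apply, e1, e2,
      smul_eq_mul]
    ring
  · refine ht.congr fun k => ?_
    simp only [Pi.smul_apply, symmMap_iterate hq, symmMap_vertex hq, Equiv.subLeft_apply, e1, e2,
      smul_eq_mul]
    ring

theorem IsMonomial.continuous {j i : ℕ} {n : Fin 3} {u : gasket q → ℝ}
    (hu : IsMonomial q j i n u) : Continuous u := HasIterLaplacian.continuous hu.1

theorem hasIterLaplacian_zero (m : ℕ) : HasIterLaplacian q m 0 0 := by
  induction m with
  | zero => rfl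
  | succ m ih =>
    refine ⟨0, ih, continuous_const, continuous_const, fun ε hε => ⟨0, fun m _ x _ _ => ?_⟩⟩
    simpa [graphLaplacian] using hε

theorem IsMonomial.ne_zero (hq : IsEquilateral q) {j : ℕ} {n : Fin 3} {u : gasket q → ℝ}
    (hu : IsMonomial q j 3 n u) : u ≠ 0 := by
  rintro rfl
  obtain ⟨f, hf, -, -, ht⟩ := hu.2 j le_rfl
  rw [hf.unique hq (hasIterLaplacian_zero j)] at ht
  simp [HasTangentialDeriv] at ht

/-! ### Gram matrix, dimension and the tight frame. -/

section Frame

variable {j : ℕ} {P : Fin 3 → gasket q → ℝ}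

theorem monomial_rotation (hq : IsEquilateral q) (hP : ∀ n, IsMonomial q j 3 n (P n))
    (n : Fin 3) (x : gasket q) : P (n + 1) (symmMap q (Equiv.addRight 1) x) = P n x :=
  congrFun (((hP (n + 1)).comp_rotation hq).unique hq (hP n)) x

theorem monomial_reflection (hq : IsEquilateral q) (hP : ∀ n, IsMonomial q j 3 n (P n))
    (a n : Fin 3) (x : gasket q) : P (a - n) (symmMap q (Equiv.subLeft a) x) = -P n x := by
  have h := congrFun (((hP (a - n)).neg_comp_reflection hq).unique hq (hP n)) x
  simp only [Pi.smul_apply, smul_eq_mul] at h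
  linarith

/-- The reflection at `q_n` permutes the summands up to the common sign `-1`, so the sum is odd
under all three reflections. -/
theorem sum_monomial (hq : IsEquilateral q) (hP : ∀ n, IsMonomial q j 3 n (P n)) :
    P 0 + P 1 + P 2 = 0 := by
  have hi : HasIterLaplacian q (j + 1) (P 0 + P 1 + P 2) 0 := by
    simpa using ((hP 0).1.add (hP 1).1).add (hP 2).1
  refine hi.eq_zero_of_odd hq fun n x => ?_
  have h : ∀ u : Fin 3 → ℝ, u 0 + u 1 + u 2 = ∑ k, u (n + n - k) := by
    intro u
    rw [← Fin.sum_univ_three]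
    exact (Equiv.sum_comp (Equiv.subLeft (n + n)) u).symm
  have h2 := h fun k => P k (symmMap q (Equiv.subLeft (n + n)) x)
  simp only [monomial_reflection hq hP, Fin.sum_univ_three] at h2
  simp only [Pi.add_apply]
  linarith

theorem l2Inner_comm (u v : gasket q → ℝ) : l2Inner q u v = l2Inner q v u := by
  unfold l2Inner; congr 1; funext x; ring

theorem l2Inner_rotation (hq : IsEquilateral q) (hP : ∀ n, IsMonomial q j 3 n (P n))
    (n m : Fin 3) : l2Inner q (P (n + 1)) (P (m + 1)) = l2Inner q (P n) (P m) := by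
  unfold l2Inner
  rw [← integral_symmMap hq (Equiv.addRight 1) (f := fun x => P (n + 1) x * P (m + 1) x)
    ((hP _).continuous.mul (hP _).continuous)]
  simp only [monomial_rotation hq hP]

theorem l2Inner_sum_left (hP : ∀ n, Continuous (P n)) (a : Fin 3 → ℝ) {v : gasket q → ℝ}
    (hv : Continuous v) : l2Inner q (∑ k, a k • P k) v = ∑ k, a k * l2Inner q (P k) v := by
  unfold l2Inner
  simp only [Finset.sum_apply, Pi.smul_apply, smul_eq_mul, Finset.sum_mul, mul_assoc]
  rw [integral_finsetSum]
  · simp only [integral_const_mul]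
  · intro k _
    exact integrable_of_continuous (continuous_const.mul ((hP k).mul hv))

/-- Rotation invariance makes the diagonal entries equal and the off-diagonal entries equal; pairing
`P 0` with the zero sum determines their ratio. -/
theorem l2Inner_monomial (hq : IsEquilateral q) (hP : ∀ n, IsMonomial q j 3 n (P n))
    (n m : Fin 3) : l2Inner q (P n) (P m)
      = if n = m then l2Inner q (P 0) (P 0) else -(l2Inner q (P 0) (P 0) / 2) := by
  have hr := l2Inner_rotation hq hP
  have h1 : l2Inner q (P 1) (P 1) = l2Inner q (P 0) (P 0) := hr 0 0
  have h2 : l2Inner q (P 2) (P 2) = l2Inner q (P 1) (P 1) := hr 1 1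
  have h3 : l2Inner q (P 1) (P 2) = l2Inner q (P 0) (P 1) := hr 0 1
  have h4 : l2Inner q (P 2) (P 0) = l2Inner q (P 1) (P 2) := hr 1 2
  have hs := l2Inner_sum_left (fun n => (hP n).continuous) (fun _ => 1) (hP 0).continuous
  simp only [Fin.sum_univ_three, one_smul, one_mul, sum_monomial hq hP] at hs
  have h0 : l2Inner q 0 (P 0) = 0 := by simp [l2Inner]
  have c1 := l2Inner_comm (P 0) (P 1)
  have c2 := l2Inner_comm (P 0) (P 2)
  have c3 := l2Inner_comm (P 1) (P 2)
  fin_cases n <;> fin_cases m <;> simp <;> linarith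

theorem l2Inner_monomial_pos (hq : IsEquilateral q) (hP : ∀ n, IsMonomial q j 3 n (P n)) :
    0 < l2Inner q (P 0) (P 0) := by
  refine lt_of_le_of_ne (integral_nonneg fun x => mul_self_nonneg _) fun h => ?_
  have h2 := eq_zero_of_integral_eq_zero ((hP 0).continuous.mul (hP 0).continuous)
    (fun x => mul_self_nonneg _) h.symm
  refine (hP 0).ne_zero hq (funext fun x => ?_)
  simpa using congrFun h2 x

/-- The Gram matrix acts on coefficients as the frame bound times the removal of the mean. -/
theorem l2Inner_combination (hq : IsEquilateral q) (hP : ∀ n, IsMonomial q j 3 n (P n))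
    (a : Fin 3 → ℝ) (n : Fin 3) : l2Inner q (∑ k, a k • P k) (P n)
      = 3 / 2 * l2Inner q (P 0) (P 0) * (a n - (a 0 + a 1 + a 2) / 3) := by
  rw [l2Inner_sum_left (fun n => (hP n).continuous) a (hP n).continuous]
  have hm := l2Inner_monomial hq hP
  generalize l2Inner q (P 0) (P 0) = c at hm ⊢
  simp only [hm, Fin.sum_univ_three]
  fin_cases n <;> simp <;> ring

theorem finrank_span_monomial (hq : IsEquilateral q) (hP : ∀ n, IsMonomial q j 3 n (P n)) :
    Module.finrank ℝ (Submodule.span ℝ (Set.range P)) = 2 := by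
  have hpos := l2Inner_monomial_pos hq hP
  have hs := sum_monomial hq hP
  have hli : LinearIndependent ℝ ![P 0, P 1] := by
    rw [LinearIndependent.pair_iff]
    intro s t hst
    have e : ∑ k, (![s, t, 0] : Fin 3 → ℝ) k • P k = 0 := by
      rw [Fin.sum_univ_three]; simpa using hst
    have h0 := l2Inner_combination hq hP ![s, t, 0] 0
    have h1 := l2Inner_combination hq hP ![s, t, 0] 1
    rw [e] at h0 h1
    simp [l2Inner] at h0 h1
    change 0 < ∫ x, P 0 x * P 0 x ∂measure q at hpos
    rcases h0 with h0 | h0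
    · linarith
    rcases h1 with h1 | h1
    · linarith
    constructor <;> linarith
  have hspan : Submodule.span ℝ (Set.range P) = Submodule.span ℝ (Set.range ![P 0, P 1]) := by
    refine le_antisymm (Submodule.span_le.mpr ?_) (Submodule.span_le.mpr ?_)
    · have m0 : P 0 ∈ Submodule.span ℝ (Set.range ![P 0, P 1]) := Submodule.subset_span ⟨0, rfl⟩
      have m1 : P 1 ∈ Submodule.span ℝ (Set.range ![P 0, P 1]) := Submodule.subset_span ⟨1, rfl⟩
      rintro _ ⟨n, rfl⟩
      fin_cases n
      · exact m0
      · exact m1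
      · have : P 2 = -(P 0 + P 1) := by rw [eq_neg_iff_add_eq_zero, add_comm]; exact hs
        change P 2 ∈ _
        rw [this]
        exact neg_mem (add_mem m0 m1)
    · rintro _ ⟨n, rfl⟩
      fin_cases n
      · exact Submodule.subset_span ⟨0, rfl⟩
      · exact Submodule.subset_span ⟨1, rfl⟩
  rw [hspan, finrank_span_eq_card hli, Fintype.card_fin]

end Frame

end Gasket

end

theorem theorem4p1 (q : Fin 3 → EuclideanSpace ℝ (Fin 2)) (hq : Gasket.IsEquilateral q)
    (j : ℕ) :
    (∀ n : Fin 3, ∃! u : Gasket.gasket q → ℝ, Gasket.IsMonomial q j 3 n u) ∧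
    ∀ P : Fin 3 → Gasket.gasket q → ℝ, (∀ n, Gasket.IsMonomial q j 3 n (P n)) →
      Module.finrank ℝ (Submodule.span ℝ (Set.range P)) = 2 ∧
      Gasket.IsTightFrame q P (3 / 2 * Gasket.l2Inner q (P 0) (P 0)) ∧
      ∀ u ∈ Submodule.span ℝ (Set.range P), ∀ x : Gasket.gasket q,
        u x = (3 / 2 * Gasket.l2Inner q (P 0) (P 0))⁻¹ *
          ∑ n, Gasket.l2Inner q u (P n) * P n x := by
  refine ⟨fun n => ?_, fun P hP => ?_⟩
  · obtain ⟨u, hu⟩ := Gasket.exists_isMonomial hq j n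
    exact ⟨u, hu, fun v hv => hv.unique hq hu⟩
  have hpos := Gasket.l2Inner_monomial_pos hq hP
  refine ⟨Gasket.finrank_span_monomial hq hP, ⟨by positivity, fun u hu => ?_⟩, fun u hu x => ?_⟩
  · obtain ⟨a, rfl⟩ := (Submodule.mem_span_range_iff_exists_fun ℝ).mp hu
    have hc : Continuous (∑ k, a k • P k) := by
      simp only [Fin.sum_univ_three]
      exact (((hP 0).continuous.const_smul _).add ((hP 1).continuous.const_smul _)).add
        ((hP 2).continuous.const_smul _)
    rw [Gasket.l2Inner_sum_left (fun n => (hP n).continuous) a hc]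
    simp only [Gasket.l2Inner_comm (P _) (∑ k, a k • P k), Gasket.l2Inner_combination hq hP]
    simp only [Fin.sum_univ_three]
    ring
  · obtain ⟨a, rfl⟩ := (Submodule.mem_span_range_iff_exists_fun ℝ).mp hu
    have hs := congrFun (Gasket.sum_monomial hq hP) x
    simp only [Gasket.l2Inner_combination hq hP]
    simp only [Fin.sum_univ_three, Pi.add_apply, Pi.smul_apply, smul_eq_mul, Pi.zero_apply] at hs ⊢
    field_simp
    -- The reconstruction returns the coefficients minus their mean; the lost mean multiplies `P 0 +
    -- P 1 + P 2 = 0`.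
    linear_combination (a 0 + a 1 + a 2) * hs
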